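/- \textbf{Setting.} A graph $G$ (in the sense of Serre) has vertices $V(G)$, oriented edges $E(G)$, endpoints $o(e),t(e)$ and a fixed-point-free involution $e\mapsto\bar e$ with $o(e)=t(\bar e)$; $\bar E(G)$ is the set of geometric edges $\{e,\bar e\}$. Let $G$ be connected and nonempty with $V(G)$ finite, and let $\mathcal G$ be a graph of groups on $G$, with vertex groups $\Gamma_v$, edge groups $\Gamma_e=\Gamma_{\bar e}$ and injective homomorphisms $h_e:\Gamma_e\to\Gamma_{t(e)}$. Let $M$ be a maximal tree of $G$ and let $\Gamma=\pi_1(\mathcal G,M)$ be the fundamental group, i.e. the quotient of the free product of all $\Gamma_v$ and the free group on $E(G)$ by the relations $e\,h_e(a)\,e^{-1}=h_{\bar e}(a)$, $\bar e=e^{-1}$, and $e=1$ for $e$ in $M$. Fix an orientation of every geometric edge and view $\Gamma_e\subseteq\Gamma$ through $\Gamma_e\to\Gamma_{t(e)}\to\Gamma$ for the chosen orientation $e$. Let $T$ be the Bass--Serre tree, $V(T)=\bigsqcup_{v\in V(G)}\Gamma/\Gamma_v$, $E(T)=\bigsqcup_{e\in\bar E(G)}\Gamma/\Gamma_e$, where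 $g\Gamma_e$ (with $e$ the chosen orientation) joins $g\Gamma_{t(e)}$ and $ge^{-1}\Gamma_{o(e)}$, and let $T'$ be its barycentric subdivision, with vertex set $V(T)\sqcup E(T)$. Put $$S_{\mathcal G}=(\Gamma\times V(G))\sqcup\bigsqcup_{e\in\bar E(G)}\Gamma/\Gamma_e,\qquad S_v=\Gamma_v\sqcup\bigsqcup_{e\in E(G),\,t(e)=v}\Gamma_v/h_e(\Gamma_e),$$ with the left multiplication actions of $\Gamma$ (trivial on the factor $V(G)$) and of $\Gamma_v$. Let $p:S_{\mathcal G}\to V(T')$ be $p(g,v)=g\Gamma_v$ and the identity on $\bigsqcup\Gamma/\Gamma_e$, and let $\phi_v:S_v\to S_{\mathcal G}$ be $\phi_v(g)=(g,v)$ and $\phi_v(g\,h_e(\Gamma_e))=g\Gamma_e$ if $e$ is the chosen orientation, $=ge^{-1}\Gamma_{\bar e}$ otherwise. For a group $H$ acting on a set $S$, $\ell^\infty_{\mathrm{alt}}(S^{n+1})^{H}$ is the space of bounded alternating $H$-invariant functions $S^{n+1}\to\mathbb R$ with the sup norm, and $\delta$ is the homogeneous coboundary $\delta f(x_0,\dots,x_{n+1})=\sum_i(-1)^if(x_0,\dots,\widehat{x_i},\dots,x_{n+1})$.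 Give $\bigoplus_v\ell^\infty_{\mathrm{alt}}(S_v^{n+1})^{\Gamma_v}$ the maximum norm and the componentwise coboundary, and let $$\phi^n:\ell^\infty_{\mathrm{alt}}(S_{\mathcal G}^{n+1})^{\Gamma}\to\bigoplus_{v\in V(G)}\ell^\infty_{\mathrm{alt}}(S_v^{n+1})^{\Gamma_v},\qquad (\phi^nF)_v=F\circ\phi_v^{\,n+1}.$$ For $w\in V(T)$ let $N(w)\subseteq V(T')$ consist of $w$ and its neighbours. A vertex $w\in V(T)$ is a \emph{barycenter} of $(y_0,\dots,y_n)\in V(T')^{n+1}$ if any two entries $y_i,y_j$, $i\ne j$, that are both different from $w$ lie in different connected components of $T'\setminus\{w\}$. Let $r_w:S_{\mathcal G}\to p^{-1}(N(w))$ be the retraction that is the identity on $p^{-1}(N(w))$ and otherwise sends $x$ to the unique element of $p^{-1}(y)$, where $y$ is the endpoint of the first edge of the path in $T'$ from $w$ to $p(x)$. For $w=g\Gamma_v$ one has $p^{-1}(N(w))=g\,\phi_v(S_v)$. \textbf{Theorem.} There are linear maps $$\psi^n:\bigoplus_{v\in V(G)}\ell^\infty_{\mathrm{alt}}(S_v^{n+1})^{\Gamma_v}\to\ell^\infty_{\mathrm{alt}}(S_{\mathcal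 G}^{n+1})^{\Gamma},\qquad n\ge2,$$ such that for all $n\ge 2$: (i) $\|\psi^n(f)\|_\infty\le\|f\|_\infty$ for all $f$; (ii) $\psi^{n+1}\circ\delta=\delta\circ\psi^n$; (iii) $\phi^n\circ\psi^n=\mathrm{id}$; and (iv) for every $f=(f_v)_v$ and $x=(x_0,\dots,x_n)\in S_{\mathcal G}^{n+1}$: if $w=g\Gamma_v$ is a barycenter of $(p(x_0),\dots,p(x_n))$, then $\psi^n(f)(x)=f_v(y_0,\dots,y_n)$, where $y_i\in S_v$ is determined by $g\,\phi_v(y_i)=r_w(x_i)$; if $(p(x_0),\dots,p(x_n))$ has no barycenter, then $\psi^n(f)(x)=0$. -/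

import Mathlib

open scoped ENNReal

noncomputable section

namespace BassSerre

/-! ### Alternating invariant bounded cochains -/

/-- `ℓ^∞_alt(S^{n+1})^Γ`: bounded real functions on `S^{n+1}` that are alternating and invariant
under the diagonal action of `Γ`, as a subspace of `ℓ^∞(S^{n+1})` (with the sup norm). -/
def altCochain (Γ S : Type*) [Group Γ] [MulAction Γ S] (n : ℕ) :
    Submodule ℝ (lp (fun _ : Fin (n + 1) → S => ℝ) ∞) where
  carrier := {f | (∀ (τ : Equiv.Perm (Fin (n + 1))) (x : Fin (n + 1) → S),
        f (x ∘ τ) = ((Equiv.Perm.sign τ : ℤ) : ℝ) * f x) ∧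
      ∀ (g : Γ) (x : Fin (n + 1) → S), f (fun i => g • x i) = f x}
  add_mem' := by
    rintro a b ⟨ha, ha'⟩ ⟨hb, hb'⟩
    refine ⟨fun τ x => ?_, fun g x => ?_⟩
    · simp only [lp.coeFn_add, Pi.add_apply, ha, hb]; ring
    · simp only [lp.coeFn_add, Pi.add_apply, ha', hb']
  zero_mem' := by simp
  smul_mem' := by
    rintro c a ⟨ha, ha'⟩
    refine ⟨fun τ x => ?_, fun g x => ?_⟩
    · simp only [lp.coeFn_smul, Pi.smul_apply, ha, smul_eq_mul]; ring
    · simp only [lp.coeFn_smul, Pi.smul_apply, ha']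

/-- The space `ℓ^∞_alt(S^{n+1})^Γ` as a (normed) type. -/
def AltCochain (Γ S : Type*) [Group Γ] [MulAction Γ S] (n : ℕ) : Type _ :=
  ↥(altCochain Γ S n)

/-- The sup norm on `ℓ^∞_alt(S^{n+1})^Γ`. -/
instance altCochainNormedAddCommGroup (Γ S : Type*) [Group Γ] [MulAction Γ S] (n : ℕ) :
    NormedAddCommGroup (AltCochain Γ S n) :=
  Submodule.normedAddCommGroup (altCochain Γ S n)

instance altCochainNormedSpace (Γ S : Type*) [Group Γ] [MulAction Γ S] (n : ℕ) :
    NormedSpace ℝ (AltCochain Γ S n) :=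
  Submodule.normedSpace (altCochain Γ S n)

section Cochains

variable {Γ S : Type*} [Group Γ] [MulAction Γ S] {n : ℕ}

/-- The value `f(x_0, …, x_n)` of a cochain. -/
def AltCochain.eval (f : AltCochain Γ S n) (x : Fin (n + 1) → S) : ℝ := f.1 x

theorem AltCochain.eval_le (f : AltCochain Γ S n) (x : Fin (n + 1) → S) :
    |f.eval x| ≤ ‖f‖ := lp.norm_apply_le_norm (by simp) f.1 x

theorem AltCochain.eval_perm (f : AltCochain Γ S n) (τ : Equiv.Perm (Fin (n + 1)))
    (x : Fin (n + 1) → S) : f.eval (x ∘ τ) = ((Equiv.Perm.sign τ : ℤ) : ℝ) * f.eval x :=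
  f.2.1 τ x

theorem AltCochain.eval_smul (f : AltCochain Γ S n) (g : Γ) (x : Fin (n + 1) → S) :
    f.eval (fun i => g • x i) = f.eval x := f.2.2 g x

/-- A bounded, alternating, invariant function as an element of `ℓ^∞_alt(S^{n+1})^Γ`. -/
def AltCochain.mk (f : (Fin (n + 1) → S) → ℝ) (hb : ∃ C, ∀ x, |f x| ≤ C)
    (ha : ∀ (τ : Equiv.Perm (Fin (n + 1))) (x : Fin (n + 1) → S),
        f (x ∘ τ) = ((Equiv.Perm.sign τ : ℤ) : ℝ) * f x)
    (hi : ∀ (g : Γ) (x : Fin (n + 1) → S), f (fun i => g • x i) = f x) : AltCochain Γ S n :=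
  ⟨⟨f, memℓp_infty (by
    obtain ⟨C, hC⟩ := hb
    exact ⟨C, by rintro _ ⟨x, rfl⟩; exact hC x⟩)⟩, ha, hi⟩

@[simp] theorem AltCochain.eval_mk (f : (Fin (n + 1) → S) → ℝ) (hb ha)
    (hi : ∀ (g : Γ) (x : Fin (n + 1) → S), f (fun i => g • x i) = f x) (x) :
    (AltCochain.mk f hb ha hi).eval x = f x := rfl

theorem AltCochain.ext_eval {f f' : AltCochain Γ S n} (h : ∀ x, f.eval x = f'.eval x) : f = f' :=
  Subtype.ext (lp.ext (funext h))

/-- The unsigned-to-signed bookkeeping for deleting a coordinate of a permuted tuple. -/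
theorem exists_perm_succAbove (τ : Equiv.Perm (Fin (n + 2))) (i : Fin (n + 2)) :
    ∃ ρ : Equiv.Perm (Fin (n + 1)), (∀ j, τ (i.succAbove j) = (τ i).succAbove (ρ j)) ∧
      (-1 : ℝ) ^ (i : ℕ) * ((Equiv.Perm.sign ρ : ℤ) : ℝ) =
        ((Equiv.Perm.sign τ : ℤ) : ℝ) * (-1) ^ (τ i : ℕ) := by
  set κ : Equiv.Perm (Fin (n + 2)) := (τ i).cycleRange * τ * i.cycleRange⁻¹ with hκ
  have h0 : κ 0 = 0 := by
    simp only [hκ, Equiv.Perm.mul_apply]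
    have : i.cycleRange⁻¹ 0 = i := by
      rw [Equiv.Perm.inv_eq_iff_eq]; simp
    simp [this]
  obtain ⟨⟨p, ρ⟩, hp⟩ := Equiv.Perm.decomposeFin.symm.surjective κ
  have hp0 : p = 0 := by
    rw [← hp, Equiv.Perm.decomposeFin_symm_apply_zero] at h0; exact h0
  subst hp0
  refine ⟨ρ, fun j => ?_, ?_⟩
  · have h1 : κ j.succ = (ρ j).succ := by
      rw [← hp, Equiv.Perm.decomposeFin_symm_apply_succ]; simp
    have h2 : i.cycleRange⁻¹ j.succ = i.succAbove j := by
      rw [Equiv.Perm.inv_eq_iff_eq]; simp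
    simp only [hκ, Equiv.Perm.mul_apply, h2] at h1
    have h3 := congrArg (τ i).cycleRange.symm h1
    simpa using h3
  · have hs : Equiv.Perm.sign κ = Equiv.Perm.sign ρ := by
      rw [← hp]; simp
    rw [← hs, hκ]
    simp only [Equiv.Perm.sign_mul, Equiv.Perm.sign_inv, Fin.sign_cycleRange]
    push_cast
    have : ((-1 : ℝ) ^ (i : ℕ)) * (-1) ^ (i : ℕ) = 1 := by
      rw [← mul_pow]; simp
    linear_combination ((-1 : ℝ) ^ (τ i : ℕ) * ((Equiv.Perm.sign τ : ℤ) : ℝ)) * this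

/-- The homogeneous coboundary `(δ f)(x_0, …, x_{n+1}) = ∑ᵢ (-1)^i f(x_0, …, x̂ᵢ, …, x_{n+1})`. -/
def delta (Γ S : Type*) [Group Γ] [MulAction Γ S] (n : ℕ) :
    AltCochain Γ S n →ₗ[ℝ] AltCochain Γ S (n + 1) where
  toFun f := AltCochain.mk
    (fun x => ∑ i : Fin (n + 2), (-1 : ℝ) ^ (i : ℕ) * f.eval (x ∘ i.succAbove))
    (by
      refine ⟨∑ _i : Fin (n + 2), ‖f‖, fun x => (Finset.abs_sum_le_sum_abs _ _).trans ?_⟩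
      refine Finset.sum_le_sum fun i _ => ?_
      simpa [abs_mul] using f.eval_le (x ∘ i.succAbove))
    (by
      intro τ x
      rw [← Equiv.sum_comp τ (fun i : Fin (n + 2) => (-1 : ℝ) ^ (i : ℕ) * f.eval (x ∘ i.succAbove)),
        Finset.mul_sum]
      refine Finset.sum_congr rfl fun i _ => ?_
      obtain ⟨ρ, h1, h2⟩ := exists_perm_succAbove τ i
      have : (x ∘ τ) ∘ i.succAbove = (x ∘ (τ i).succAbove) ∘ ρ := by
        funext j; simp [h1]
      rw [this, f.eval_perm, ← mul_assoc, h2, mul_assoc])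
    (by
      intro g x
      exact Finset.sum_congr rfl fun i _ =>
        congrArg _ (f.eval_smul g (x ∘ i.succAbove)))
  map_add' a b := AltCochain.ext_eval fun x => by
    change ∑ i : Fin (n + 2), (-1 : ℝ) ^ (i : ℕ) * (a.eval _ + b.eval _) =
      ∑ i : Fin (n + 2), (-1 : ℝ) ^ (i : ℕ) * a.eval _ +
      ∑ i : Fin (n + 2), (-1 : ℝ) ^ (i : ℕ) * b.eval _
    simp only [mul_add, Finset.sum_add_distrib]
  map_smul' c a := AltCochain.ext_eval fun x => by
    change ∑ i : Fin (n + 2), (-1 : ℝ) ^ (i : ℕ) * (c * a.eval _) =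
      c * ∑ i : Fin (n + 2), (-1 : ℝ) ^ (i : ℕ) * a.eval _
    rw [Finset.mul_sum]
    exact Finset.sum_congr rfl fun i _ => by ring

end Cochains

/-! ### Graphs and graphs of groups -/

/-- A graph in the sense of Serre, with vertex set `V` and set of oriented edges `E`. -/
structure SerreGraph (V E : Type*) where
  /-- origin -/
  o : E → V
  /-- terminus -/
  t : E → V
  /-- orientation reversal -/
  bar : E → E
  bar_bar : ∀ e, bar (bar e) = e
  bar_ne : ∀ e, bar e ≠ e
  o_eq : ∀ e, o e = t (bar e)

namespace SerreGraph

variable {V E : Type*} (G : SerreGraph V E)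

/-- `e` and `ē` are the same geometric edge. -/
def edgeSetoid : Setoid E where
  r e e' := e' = e ∨ e' = G.bar e
  iseqv :=
    { refl := fun _ => Or.inl rfl
      symm := by
        rintro e e' (rfl | rfl)
        · exact Or.inl rfl
        · exact Or.inr (G.bar_bar e).symm
      trans := by
        rintro a b c (rfl | rfl) (rfl | rfl)
        · exact Or.inl rfl
        · exact Or.inr rfl
        · exact Or.inr rfl
        · exact Or.inl (G.bar_bar a) }

/-- The set of geometric edges `{e, ē}`. -/
def GeomEdge : Type _ := Quotient G.edgeSetoid

/-- The geometric edge underlying an oriented edge. -/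
def geom (e : E) : G.GeomEdge := Quotient.mk G.edgeSetoid e

theorem geom_bar (e : E) : G.geom (G.bar e) = G.geom e :=
  Quotient.sound (s := G.edgeSetoid) (Or.inr (G.bar_bar e).symm)

theorem eq_or_eq_bar {e e' : E} (h : G.geom e = G.geom e') : e' = e ∨ e' = G.bar e :=
  Quotient.exact (s := G.edgeSetoid) h

/-- A chosen orientation of a geometric edge. -/
def ori (ε : G.GeomEdge) : E := Quotient.out ε

theorem geom_ori (ε : G.GeomEdge) : G.geom (G.ori ε) = ε := Quotient.out_eq ε

/-- `M` is (the edge set of) a maximal tree: the subgraph `(V, M)` is a tree, i.e. it has no loops,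
no multiple edges, and its underlying simple graph is a (nonempty, connected, acyclic) tree.
The existence of such an `M` means that `G` is nonempty and connected. -/
structure IsMaximalTree (M : Set E) : Prop where
  bar_mem : ∀ e ∈ M, G.bar e ∈ M
  no_loop : ∀ e ∈ M, G.o e ≠ G.t e
  no_multiple : ∀ e ∈ M, ∀ e' ∈ M, G.o e = G.o e' → G.t e = G.t e' → e = e'
  isTree : (SimpleGraph.fromRel fun a b => ∃ e ∈ M, G.o e = a ∧ G.t e = b).IsTree

end SerreGraph

/-- A graph of groups based on `G`. Edge groups are indexed by geometric edges (so `Γ_e = Γ_ē`), and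
every orientation `e` of `ε` comes with an injective homomorphism `h_e : Γ_ε → Γ_{t(e)}`. -/
structure GraphOfGroups {V E : Type*} (G : SerreGraph V E) where
  /-- the vertex groups -/
  vertexGroup : V → Type*
  /-- the edge groups -/
  edgeGroup : G.GeomEdge → Type*
  [vertexGroup_group : ∀ v, Group (vertexGroup v)]
  [edgeGroup_group : ∀ ε, Group (edgeGroup ε)]
  /-- the edge homomorphisms -/
  h : ∀ (ε : G.GeomEdge) (e : E), G.geom e = ε → (edgeGroup ε →* vertexGroup (G.t e))
  h_injective : ∀ ε e he, Function.Injective (h ε e he)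

attribute [instance] GraphOfGroups.vertexGroup_group GraphOfGroups.edgeGroup_group

namespace GraphOfGroups

variable {V E : Type*} {G : SerreGraph V E} (𝒢 : GraphOfGroups G) (M : Set E)

/-! ### The fundamental group -/

/-- The free product of all vertex groups and of the free group on the oriented edges. -/
abbrev FreeProd : Type _ := Monoid.Coprod (Monoid.CoprodI 𝒢.vertexGroup) (FreeGroup E)

/-- A vertex group element in the free product. -/
def preVertex (v : V) : 𝒢.vertexGroup v →* 𝒢.FreeProd :=
  Monoid.Coprod.inl.comp Monoid.CoprodI.of

/-- An edge letter in the free product. -/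
def preEdge (e : E) : 𝒢.FreeProd := Monoid.Coprod.inr (FreeGroup.of e)

/-- The relators of the fundamental group: `e h_e(a) e⁻¹ = h_ē(a)`, `ē = e⁻¹`, and `e = 1` for the
edges `e` of the maximal tree `M`. -/
def relators : Set 𝒢.FreeProd :=
  {x | ∃ (ε : G.GeomEdge) (e : E) (he : G.geom e = ε) (a : 𝒢.edgeGroup ε),
      x = 𝒢.preEdge e * 𝒢.preVertex _ (𝒢.h ε e he a) * (𝒢.preEdge e)⁻¹ *
        (𝒢.preVertex _ (𝒢.h ε (G.bar e) ((G.geom_bar e).trans he) a))⁻¹} ∪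
  {x | ∃ e : E, x = 𝒢.preEdge (G.bar e) * 𝒢.preEdge e} ∪
  {x | ∃ e ∈ M, x = 𝒢.preEdge e}

/-- The fundamental group `π₁(𝒢, M)` of the graph of groups relative to a maximal tree `M`. -/
def FundGroup : Type _ := 𝒢.FreeProd ⧸ Subgroup.normalClosure (𝒢.relators M)

instance : Group (𝒢.FundGroup M) :=
  inferInstanceAs (Group (𝒢.FreeProd ⧸ Subgroup.normalClosure (𝒢.relators M)))

/-- The quotient map from the free product. -/
def proj : 𝒢.FreeProd →* 𝒢.FundGroup M :=
  QuotientGroup.mk' (Subgroup.normalClosure (𝒢.relators M))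

/-- The canonical homomorphism `Γ_v → Γ`. -/
def vertexMap (v : V) : 𝒢.vertexGroup v →* 𝒢.FundGroup M :=
  (𝒢.proj M).comp (𝒢.preVertex v)

/-- The element of `Γ` given by the oriented edge `e`. -/
def edgeElt (e : E) : 𝒢.FundGroup M := 𝒢.proj M (𝒢.preEdge e)

theorem edge_relation (ε : G.GeomEdge) (e : E) (he : G.geom e = ε) (a : 𝒢.edgeGroup ε) :
    𝒢.edgeElt M e * 𝒢.vertexMap M _ (𝒢.h ε e he a) * (𝒢.edgeElt M e)⁻¹ =
      𝒢.vertexMap M _ (𝒢.h ε (G.bar e) ((G.geom_bar e).trans he) a) := by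
  have hx := Subgroup.subset_normalClosure (s := 𝒢.relators M)
    (Or.inl (Or.inl ⟨ε, e, he, a, rfl⟩))
  have hx' := (QuotientGroup.eq_one_iff _).2 hx
  exact mul_inv_eq_one.1 hx'

/-- The subgroup `Γ_v` of `Γ`. -/
def vertexSubgroup (v : V) : Subgroup (𝒢.FundGroup M) := (𝒢.vertexMap M v).range

/-- The edge group `Γ_e`, embedded in `Γ` via `h_e` and `Γ_{t(e)} → Γ`. -/
def edgeSubgroup (e : E) : Subgroup (𝒢.FundGroup M) :=
  ((𝒢.vertexMap M (G.t e)).comp (𝒢.h (G.geom e) e rfl)).range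

/-! ### The Bass–Serre tree and its barycentric subdivision -/

/-- Vertices of the Bass–Serre tree: `V(T) = ⨆_v Γ/Γ_v`. -/
def TreeVertex : Type _ := Σ v : V, 𝒢.FundGroup M ⧸ 𝒢.vertexSubgroup M v

/-- Geometric edges of the Bass–Serre tree: `E(T) = ⨆_ε Γ/Γ_ε`, where `Γ_ε ⊆ Γ` is the edge
subgroup for the chosen orientation of `ε`. -/
def TreeEdge : Type _ := Σ ε : G.GeomEdge, 𝒢.FundGroup M ⧸ 𝒢.edgeSubgroup M (G.ori ε)

/-- The vertex `gΓ_v`. -/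
def vtx (v : V) (g : 𝒢.FundGroup M) : 𝒢.TreeVertex M := ⟨v, QuotientGroup.mk g⟩

/-- The edge `gΓ_ε`. -/
def edg (ε : G.GeomEdge) (g : 𝒢.FundGroup M) : 𝒢.TreeEdge M := ⟨ε, QuotientGroup.mk g⟩

/-- Incidence in the Bass–Serre tree: if `e` is the chosen orientation of `ε`, then the
endpoints of `gΓ_ε` are `gΓ_{t(e)}` and `g e⁻¹ Γ_{o(e)}`. -/
def Incident (w : 𝒢.TreeVertex M) (η : 𝒢.TreeEdge M) : Prop :=
  ∃ (ε : G.GeomEdge) (g : 𝒢.FundGroup M), η = 𝒢.edg M ε g ∧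
    (w = 𝒢.vtx M (G.t (G.ori ε)) g ∨
      w = 𝒢.vtx M (G.o (G.ori ε)) (g * (𝒢.edgeElt M (G.ori ε))⁻¹))

/-- The barycentric subdivision `T'` of the Bass–Serre tree: its vertices are the vertices and the
geometric edges of `T`, adjacency is incidence. -/
def subdivision : SimpleGraph (𝒢.TreeVertex M ⊕ 𝒢.TreeEdge M) where
  Adj
    | Sum.inl w, Sum.inr η => 𝒢.Incident M w η
    | Sum.inr η, Sum.inl w => 𝒢.Incident M w η
    | _, _ => False
  symm := ⟨by rintro (a | a) (b | b) h <;> exact h⟩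
  loopless := ⟨by rintro (a | a) h <;> exact h⟩

/-- `N(w)`: the vertices of `T'` at distance at most one from `w`. -/
def nbhd (w : 𝒢.TreeVertex M) : Set (𝒢.TreeVertex M ⊕ 𝒢.TreeEdge M) :=
  {y | y = Sum.inl w ∨ (𝒢.subdivision M).Adj (Sum.inl w) y}

/-- `w ∈ V(T)` is a barycenter of the tuple `y` of vertices of `T'`: any two entries `y i`, `y j`
(`i ≠ j`) different from `w` lie in different connected components of `T' ∖ {w}`. -/
def IsBarycenter {n : ℕ} (w : 𝒢.TreeVertex M)
    (y : Fin (n + 1) → 𝒢.TreeVertex M ⊕ 𝒢.TreeEdge M) : Prop :=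
  ∀ i j, i ≠ j → ∀ (hi : y i ∈ ({Sum.inl w}ᶜ : Set _)) (hj : y j ∈ ({Sum.inl w}ᶜ : Set _)),
    ((𝒢.subdivision M).induce {Sum.inl w}ᶜ).connectedComponentMk ⟨y i, hi⟩ ≠
      ((𝒢.subdivision M).induce {Sum.inl w}ᶜ).connectedComponentMk ⟨y j, hj⟩

/-! ### The set `S_𝒢` -/

/-- `S_𝒢 = (Γ × V(G)) ⊔ ⨆_ε Γ/Γ_ε`. -/
inductive GlobalSet : Type _
  | pt (g : 𝒢.FundGroup M) (v : V) : GlobalSet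
  | edge (ε : G.GeomEdge) (c : 𝒢.FundGroup M ⧸ 𝒢.edgeSubgroup M (G.ori ε)) : GlobalSet

/-- `Γ` acts on `S_𝒢` by left multiplication. -/
instance : MulAction (𝒢.FundGroup M) (𝒢.GlobalSet M) where
  smul g₀
    | .pt g v => .pt (g₀ * g) v
    | .edge ε c => .edge ε (g₀ • c)
  one_smul := by
    rintro (⟨g, v⟩ | ⟨ε, c⟩)
    · exact congrArg (GlobalSet.pt · v) (one_mul g)
    · exact congrArg (GlobalSet.edge ε) (one_smul _ c)
  mul_smul a b := by
    rintro (⟨g, v⟩ | ⟨ε, c⟩)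
    · exact congrArg (GlobalSet.pt · v) (mul_assoc a b g)
    · exact congrArg (GlobalSet.edge ε) (mul_smul a b c)

/-- The projection `p : S_𝒢 → V(T')`, `(g, v) ↦ gΓ_v`, the identity on edges. -/
def p : 𝒢.GlobalSet M → 𝒢.TreeVertex M ⊕ 𝒢.TreeEdge M
  | .pt g v => Sum.inl (𝒢.vtx M v g)
  | .edge ε c => Sum.inr ⟨ε, c⟩

/-- `s = r_w(x)`, where `r_w` is the retraction of `S_𝒢` onto `S_w = p⁻¹(N(w))`: either
`x ∈ S_w` and `s = x`, or `x ∉ S_w` and `p s` is the endpoint of the first edge of the path in `T'`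
from `w` to `p x`. -/
def IsRetraction (w : 𝒢.TreeVertex M) (x s : 𝒢.GlobalSet M) : Prop :=
  (𝒢.p M x ∈ 𝒢.nbhd M w ∧ s = x) ∨
  (𝒢.p M x ∉ 𝒢.nbhd M w ∧ ∃ P : (𝒢.subdivision M).Walk (Sum.inl w) (𝒢.p M x),
    P.IsPath ∧ P.snd = 𝒢.p M s)

/-! ### The sets `S_v` -/

/-- `Γ_e` as a subgroup of `Γ_v`, via `h_e`, for an oriented edge `e` with `t(e) = v`. -/
def localSubgroup (v : V) (e : E) (he : G.t e = v) : Subgroup (𝒢.vertexGroup v) :=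
  he ▸ (𝒢.h (G.geom e) e rfl).range

/-- `S_v = Γ_v ⊔ ⨆_{t(e) = v} Γ_v/Γ_e`, the union over oriented edges `e` ending at `v`. -/
inductive LocalSet (v : V) : Type _
  | pt (g : 𝒢.vertexGroup v) : LocalSet v
  | edge (e : E) (he : G.t e = v) (c : 𝒢.vertexGroup v ⧸ 𝒢.localSubgroup v e he) : LocalSet v

/-- `Γ_v` acts on `S_v` by left multiplication. -/
instance (v : V) : MulAction (𝒢.vertexGroup v) (𝒢.LocalSet v) where
  smul g₀
    | .pt g => .pt (g₀ * g)
    | .edge e he c => .edge e he (g₀ • c)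
  one_smul := by
    rintro (g | ⟨e, he, c⟩)
    · exact congrArg LocalSet.pt (one_mul g)
    · exact congrArg (LocalSet.edge e he) (one_smul _ c)
  mul_smul a b := by
    rintro (g | ⟨e, he, c⟩)
    · exact congrArg LocalSet.pt (mul_assoc a b g)
    · exact congrArg (LocalSet.edge e he) (mul_smul a b c)

open Classical in
/-- The element of `Γ` comparing the two embeddings of an edge group: the tree edge that is written
`gΓ_e` for the orientation `e` is `g · shift e · Γ_ε` for the chosen orientation of `ε = {e, ē}`. It
is `1` if `e` is the chosen orientation and `e⁻¹` otherwise (recall `h_e(a) e⁻¹ = e⁻¹ h_ē(a)`). -/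
def shift (e : E) : 𝒢.FundGroup M :=
  if G.ori (G.geom e) = e then 1 else (𝒢.edgeElt M e)⁻¹

theorem shift_conj (v : V) (e : E) (he : G.t e = v) (a : 𝒢.vertexGroup v)
    (ha : a ∈ 𝒢.localSubgroup v e he) :
    (𝒢.shift M e)⁻¹ * 𝒢.vertexMap M v a * 𝒢.shift M e ∈ 𝒢.edgeSubgroup M (G.ori (G.geom e)) := by
  subst he
  obtain ⟨b, rfl⟩ := ha
  unfold shift
  split_ifs with h1
  · rw [h1]
    exact ⟨b, by simp⟩
  · have h2 : G.ori (G.geom e) = G.bar e :=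
      (G.eq_or_eq_bar (G.geom_ori (G.geom e)).symm).resolve_left h1
    rw [h2, inv_inv, 𝒢.edge_relation M (G.geom e) e rfl b]
    have key : ∀ (ε : G.GeomEdge) (hε : G.geom (G.bar e) = ε) (b : 𝒢.edgeGroup ε),
        𝒢.vertexMap M _ (𝒢.h ε (G.bar e) hε b) ∈ 𝒢.edgeSubgroup M (G.bar e) := by
      rintro _ rfl b
      exact ⟨b, rfl⟩
    exact key _ _ b

/-- The map `φ_v : S_v → S_𝒢`, `g ↦ (g, v)`, `gΓ_e ↦ gΓ_e`. -/
def phiMap (v : V) : 𝒢.LocalSet v → 𝒢.GlobalSet M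
  | .pt g => .pt (𝒢.vertexMap M v g) v
  | .edge e he c => .edge (G.geom e) (Quotient.liftOn' c
      (fun g => (QuotientGroup.mk (𝒢.vertexMap M v g * 𝒢.shift M e) :
        𝒢.FundGroup M ⧸ 𝒢.edgeSubgroup M (G.ori (G.geom e))))
      (by
        intro a b hab
        rw [QuotientGroup.leftRel_apply] at hab
        refine QuotientGroup.eq.2 ?_
        have := 𝒢.shift_conj M v e he _ hab
        simpa [mul_assoc] using this))

theorem phiMap_smul (v : V) (g : 𝒢.vertexGroup v) (s : 𝒢.LocalSet v) :
    𝒢.phiMap M v (g • s) = 𝒢.vertexMap M v g • 𝒢.phiMap M v s := by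
  rcases s with a | ⟨e, he, c⟩
  · exact congrArg (GlobalSet.pt · v) (map_mul _ g a)
  · induction c using QuotientGroup.induction_on with
    | H a =>
      refine congrArg (GlobalSet.edge (G.geom e)) ?_
      change (QuotientGroup.mk (𝒢.vertexMap M v (g * a) * 𝒢.shift M e) :
        𝒢.FundGroup M ⧸ 𝒢.edgeSubgroup M (G.ori (G.geom e))) =
        QuotientGroup.mk (𝒢.vertexMap M v g * (𝒢.vertexMap M v a * 𝒢.shift M e))
      rw [map_mul, mul_assoc]

/-- The restriction map `φ^n : ℓ^∞_alt(S_𝒢^{n+1})^Γ → ⨁_v ℓ^∞_alt(S_v^{n+1})^{Γ_v}`,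
`(φ^n F)_v = F ∘ (φ_v × ⋯ × φ_v)`. -/
def phi (n : ℕ) : AltCochain (𝒢.FundGroup M) (𝒢.GlobalSet M) n →ₗ[ℝ]
    ∀ v, AltCochain (𝒢.vertexGroup v) (𝒢.LocalSet v) n where
  toFun F v := AltCochain.mk (fun y => F.eval (𝒢.phiMap M v ∘ y))
    ⟨‖F‖, fun y => F.eval_le _⟩
    (fun τ y => F.eval_perm τ (𝒢.phiMap M v ∘ y))
    (fun g y => by
      rw [← F.eval_smul (𝒢.vertexMap M v g) (𝒢.phiMap M v ∘ y)]
      exact congrArg F.eval (funext fun i => 𝒢.phiMap_smul M v g (y i)))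
  map_add' _ _ := rfl
  map_smul' _ _ := rfl

end GraphOfGroups

end BassSerre

end

/-!
The proof rests on two facts: the Bass–Serre tree really is a tree, and cochains on a tuple of points
of a tree are governed by barycenters.

**The tree.** No normal forms are needed. By `FundGroup.exists_hom_of_edge_data`, homomorphisms
`ρ_v : Γ_v → P` and elements `σ_e ∈ P` satisfying `σ_e ρ(h_e(a)) σ_e⁻¹ = ρ(h_ē(a))` extend to
`Γ → P` after conjugation by a `P`-valued potential of `σ` on the maximal tree. This is used twice.

* With `P` the permutation group of `K × Z`, where `K` is the product of all vertex groups and `Z` is a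
  large infinite set: an edge group acts freely with `|Z|` orbits through both of its embeddings, so
  the two actions are conjugate. Hence `Γ_v → Γ` is injective (`vertexMap_injective`).
* With `P` the affine group of `ℤ^{E(T)}`: this yields, for each edge `η` of `T`, an integer-valued
  function on `V(T)` that jumps across `η` and across no other edge (`exists_edge_separating`).
  So every edge is a bridge and `T` is a forest without loops.

Connectedness follows from the fact that `Γ` is generated by the vertex groups and the edges.

**Barycenters.** Components of `T' ∖ {w}` are labelled by the first vertex on the path from `w`
(`toward`), and the retraction `r_w` only depends on this label. A tuple of at least three points has
at most one barycenter (`IsBarycenter.unique`), so `ψ(f)(x)` may be defined by the barycenter formula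
(`extendFun`); it is alternating and invariant by uniqueness.

For `δψ = ψδ`, a barycenter of `x` stays a barycenter when an entry is omitted. If `x` has none but
`w` becomes one when `x_i` is omitted, then exactly one other `x_j` lies in the branch of `x_i` at
`w`, and the terms of the coboundary for `i` and `j` cancel (`sum_extendFun_succAbove_eq_zero`).
For `φψ = id`, a tuple in the star of `w` either has barycenter `w` or has two equal entries, and
then alternating functions vanish.
-/

noncomputable section

namespace BassSerre

/-! ### Potentials on trees -/

/-- A group-valued antisymmetric function on the oriented edges of a tree is the coboundary of a
function on the vertices, whose values can be kept in any subgroup containing the edge values. -/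
theorem exists_potential_of_isTree {V P : Type*} [Group P] {S : SimpleGraph V} (hS : S.IsTree)
    (u : V → V → P) (hu : ∀ a b, S.Adj a b → u a b * u b a = 1) (Q : Subgroup P)
    (hQ : ∀ a b, S.Adj a b → u a b ∈ Q) :
    ∃ τ : V → P, (∀ v, τ v ∈ Q) ∧ ∀ a b, S.Adj a b → τ b = τ a * u a b := by
  classical
  obtain ⟨r⟩ := hS.connected.nonempty
  choose q hq hq' using hS.existsUnique_path r
  let wt : ∀ {a b : V}, S.Walk a b → P := fun w => (w.darts.map fun d => u d.fst d.snd).prod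
  have hconcat : ∀ {a b : V} (h : S.Adj a b), b ∉ (q a).support → wt (q b) = wt (q a) * u a b := by
    intro a b h hb
    rw [← hq' b ((q a).concat h) ((hq a).concat hb h)]
    simp [wt, SimpleGraph.Walk.darts_concat, List.concat_eq_append]
  refine ⟨fun v => wt (q v), fun v => Subgroup.list_prod_mem _ fun x hx => ?_, fun a b h => ?_⟩
  · obtain ⟨d, -, rfl⟩ := List.mem_map.1 hx
    exact hQ _ _ d.adj
  · by_cases hb : b ∈ (q a).support
    · have ha := hS.isAcyclic.ne_mem_support_of_support_of_adj_of_isPath (hq a) (hq b) h hb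
      change wt (q b) = wt (q a) * u a b
      rw [hconcat h.symm ha, mul_assoc, hu b a h.symm, mul_one]
    · exact hconcat h hb

namespace SerreGraph

variable {V E : Type*} {G : SerreGraph V E}

theorem t_bar (G : SerreGraph V E) (e : E) : G.t (G.bar e) = G.o e := (G.o_eq e).symm

theorem o_bar (G : SerreGraph V E) (e : E) : G.o (G.bar e) = G.t e := by
  rw [G.o_eq, G.bar_bar]

/-- Every oriented edge is the chosen orientation of its geometric edge, or the reverse of it. -/
theorem ori_geom_eq_or (G : SerreGraph V E) (e : E) :
    G.ori (G.geom e) = e ∨ G.ori (G.geom e) = G.bar e :=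
  G.eq_or_eq_bar (G.geom_ori (G.geom e)).symm

theorem exists_ori_or_bar_ori (G : SerreGraph V E) (e : E) :
    ∃ ε : G.GeomEdge, e = G.ori ε ∨ e = G.bar (G.ori ε) := by
  refine ⟨G.geom e, (G.ori_geom_eq_or e).imp Eq.symm fun h => ?_⟩
  rw [h, G.bar_bar]

theorem ori_geom_ori (G : SerreGraph V E) (ε : G.GeomEdge) :
    G.ori (G.geom (G.ori ε)) = G.ori ε := by rw [G.geom_ori]

theorem ori_geom_bar_ori (G : SerreGraph V E) (ε : G.GeomEdge) :
    G.ori (G.geom (G.bar (G.ori ε))) = G.ori ε := by rw [G.geom_bar, G.geom_ori]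

theorem IsMaximalTree.exists_potential {M : Set E} (hM : G.IsMaximalTree M) {P : Type*} [Group P]
    (σ : E → P) (hbar : ∀ e ∈ M, σ e * σ (G.bar e) = 1) (Q : Subgroup P)
    (hQ : ∀ e ∈ M, σ e ∈ Q) :
    ∃ τ : V → P, (∀ v, τ v ∈ Q) ∧ ∀ e ∈ M, τ (G.t e) = τ (G.o e) * σ e := by
  classical
  let u : V → V → P := fun a b => if h : ∃ e ∈ M, G.o e = a ∧ G.t e = b then σ h.choose else 1
  have hu : ∀ e ∈ M, u (G.o e) (G.t e) = σ e := by
    intro e he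
    have h : ∃ e' ∈ M, G.o e' = G.o e ∧ G.t e' = G.t e := ⟨e, he, rfl, rfl⟩
    have h1 : u (G.o e) (G.t e) = σ h.choose := dif_pos h
    rw [h1, hM.no_multiple _ h.choose_spec.1 e he h.choose_spec.2.1 h.choose_spec.2.2]
  have hadj : ∀ a b, (SimpleGraph.fromRel fun a b => ∃ e ∈ M, G.o e = a ∧ G.t e = b).Adj a b →
      ∃ e ∈ M, G.o e = a ∧ G.t e = b := by
    rintro a b ⟨-, ⟨e, he, h1, h2⟩ | ⟨e, he, h1, h2⟩⟩
    · exact ⟨e, he, h1, h2⟩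
    · exact ⟨G.bar e, hM.bar_mem e he, (G.o_bar e).trans h2, (G.t_bar e).trans h1⟩
  obtain ⟨τ, h1, h2⟩ := exists_potential_of_isTree hM.isTree u (fun a b h => by
    obtain ⟨e, he, rfl, rfl⟩ := hadj a b h
    have := hu _ (hM.bar_mem e he)
    rw [G.o_bar, G.t_bar] at this
    rw [hu e he, this, hbar e he]) Q (fun a b h => by
    obtain ⟨e, he, rfl, rfl⟩ := hadj a b h
    rw [hu e he]
    exact hQ e he)
  refine ⟨τ, h1, fun e he => ?_⟩
  rw [h2 (G.o e) (G.t e) ⟨hM.no_loop e he, Or.inl ⟨e, he, rfl, rfl⟩⟩, hu e he]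

end SerreGraph

namespace GraphOfGroups

variable {V E : Type*} {G : SerreGraph V E} (𝒢 : GraphOfGroups G) (M : Set E)

/-! ### Generators and homomorphisms out of the fundamental group -/

theorem edgeElt_bar (e : E) : 𝒢.edgeElt M (G.bar e) = (𝒢.edgeElt M e)⁻¹ := by
  have hx := Subgroup.subset_normalClosure (s := 𝒢.relators M)
    (Or.inl (Or.inr ⟨e, rfl⟩))
  exact eq_inv_of_mul_eq_one_left ((QuotientGroup.eq_one_iff _).2 hx)

theorem edgeElt_of_mem {e : E} (he : e ∈ M) : 𝒢.edgeElt M e = 1 :=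
  (QuotientGroup.eq_one_iff _).2
    (Subgroup.subset_normalClosure (s := 𝒢.relators M) (Or.inr ⟨e, he, rfl⟩))

/-- The fundamental group is generated by the vertex groups and the chosen orientations of the
edges. -/
theorem FundGroup.induction {motive : 𝒢.FundGroup M → Prop} (one : motive 1)
    (vertex : ∀ v γ, motive (𝒢.vertexMap M v γ))
    (edge : ∀ ε, motive (𝒢.edgeElt M (G.ori ε)))
    (inv : ∀ g, motive g → motive g⁻¹)
    (mul : ∀ g g', motive g → motive g' → motive (g * g')) (g : 𝒢.FundGroup M) : motive g := by
  have edge' : ∀ e, motive (𝒢.edgeElt M e) := by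
    intro e
    obtain ⟨ε, rfl | rfl⟩ := G.exists_ori_or_bar_ori e
    · exact edge ε
    · rw [edgeElt_bar]
      exact inv _ (edge ε)
  obtain ⟨x, rfl⟩ := QuotientGroup.mk'_surjective _ g
  change motive (𝒢.proj M x)
  induction x using Monoid.Coprod.induction_on with
  | inl m =>
    induction m using Monoid.CoprodI.induction_on with
    | one => simpa using one
    | of v γ => exact vertex v γ
    | mul x y hx hy => simpa using mul _ _ hx hy
  | inr n =>
    induction n with
    | C1 => simpa using one
    | of e => exact edge' e
    | inv_of e _ =>
      rw [map_inv, map_inv]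
      exact inv _ (edge' e)
    | mul x y hx hy => simpa using mul _ _ hx hy
  | mul x y hx hy => simpa using mul _ _ hx hy

/-- The universal property of the fundamental group. -/
theorem FundGroup.exists_lift {P : Type*} [Group P] (ρ : ∀ v, 𝒢.vertexGroup v →* P) (σ : E → P)
    (hrel : ∀ (ε : G.GeomEdge) (e : E) (he : G.geom e = ε) (a : 𝒢.edgeGroup ε),
      σ e * ρ _ (𝒢.h ε e he a) * (σ e)⁻¹ *
        (ρ _ (𝒢.h ε (G.bar e) ((G.geom_bar e).trans he) a))⁻¹ = 1)
    (hbar : ∀ e, σ (G.bar e) * σ e = 1) (hM : ∀ e ∈ M, σ e = 1) :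
    ∃ Ψ : 𝒢.FundGroup M →* P, (∀ v γ, Ψ (𝒢.vertexMap M v γ) = ρ v γ) ∧
      ∀ e, Ψ (𝒢.edgeElt M e) = σ e := by
  let Φ : 𝒢.FreeProd →* P := Monoid.Coprod.lift (Monoid.CoprodI.lift ρ) (FreeGroup.lift σ)
  have hv : ∀ v γ, Φ (𝒢.preVertex v γ) = ρ v γ := fun v γ => by simp [Φ, preVertex]
  have he : ∀ e, Φ (𝒢.preEdge e) = σ e := fun e => by simp [Φ, preEdge]
  have hle : Subgroup.normalClosure (𝒢.relators M) ≤ Φ.ker := by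
    refine Subgroup.normalClosure_le_normal ?_
    rintro x ((⟨ε, e, h, a, rfl⟩ | ⟨e, rfl⟩) | ⟨e, h, rfl⟩)
    · simpa only [SetLike.mem_coe, MonoidHom.mem_ker, map_mul, map_inv, hv, he] using hrel ε e h a
    · simpa only [SetLike.mem_coe, MonoidHom.mem_ker, map_mul, he] using hbar e
    · simpa only [SetLike.mem_coe, MonoidHom.mem_ker, he] using hM e h
  exact ⟨QuotientGroup.lift _ Φ hle, hv, he⟩

/-- Data `ρ_v : Γ_v → P` and `σ_ε ∈ P` that satisfy the relations `σ h_e(a) σ⁻¹ = h_ē(a)` only give a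
homomorphism on `π₁(𝒢, M)` after `σ` has been made trivial along `M`. Conjugating by a potential `τ`
of `σ` on the tree `M` achieves this. -/
theorem FundGroup.exists_hom_of_edge_data {M : Set E} (hM : G.IsMaximalTree M) {P : Type*}
    [Group P] (ρ : ∀ v, 𝒢.vertexGroup v →* P) (σ : G.GeomEdge → P)
    (hσ : ∀ (ε : G.GeomEdge) (a : 𝒢.edgeGroup ε),
      σ ε * ρ _ (𝒢.h ε (G.ori ε) (G.geom_ori ε) a) =
        ρ _ (𝒢.h ε (G.bar (G.ori ε)) ((G.geom_bar _).trans (G.geom_ori ε)) a) * σ ε)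
    (Q : Subgroup P) (hQ : ∀ ε, G.ori ε ∈ M → σ ε ∈ Q) :
    ∃ (τ : V → P) (Ψ : 𝒢.FundGroup M →* P), (∀ v, τ v ∈ Q) ∧
      (∀ v γ, Ψ (𝒢.vertexMap M v γ) = τ v * ρ v γ * (τ v)⁻¹) ∧
      ∀ ε, Ψ (𝒢.edgeElt M (G.ori ε)) = τ (G.o (G.ori ε)) * σ ε * (τ (G.t (G.ori ε)))⁻¹ := by
  classical
  -- Extend `σ` from the chosen orientations to all oriented edges by `σ_ē = σ_e⁻¹`.
  let s : E → P := fun e => if G.ori (G.geom e) = e then σ (G.geom e) else (σ (G.geom e))⁻¹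
  have hs : ∀ ε, s (G.ori ε) = σ ε := by
    intro ε
    simp only [s, G.geom_ori, if_true]
  have hs' : ∀ ε, s (G.bar (G.ori ε)) = (σ ε)⁻¹ := by
    intro ε
    simp only [s, G.geom_bar, G.geom_ori, if_neg (G.bar_ne _).symm]
  have hsbar : ∀ e, s e * s (G.bar e) = 1 := by
    intro e
    obtain ⟨ε, rfl | rfl⟩ := G.exists_ori_or_bar_ori e
    · rw [hs, hs', mul_inv_cancel]
    · rw [G.bar_bar, hs, hs', inv_mul_cancel]
  have hcongr : ∀ (ε : G.GeomEdge) (e e' : E) (h : e' = e) (he : G.geom e = ε)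
      (he' : G.geom e' = ε) (a : 𝒢.edgeGroup ε),
      ρ _ (𝒢.h ε e he a) = ρ _ (𝒢.h ε e' he' a) := by
    rintro ε e _ rfl he he' a
    rfl
  have hsrel : ∀ (ε : G.GeomEdge) (e : E) (he : G.geom e = ε) (a : 𝒢.edgeGroup ε),
      s e * ρ _ (𝒢.h ε e he a) =
        ρ _ (𝒢.h ε (G.bar e) ((G.geom_bar e).trans he) a) * s e := by
    rintro ε e he a
    obtain ⟨ε', rfl | rfl⟩ := G.exists_ori_or_bar_ori e
    · obtain rfl : ε' = ε := (G.geom_ori ε').symm.trans he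
      rw [hs]
      exact hσ ε' a
    · obtain rfl : ε' = ε := ((G.geom_bar _).trans (G.geom_ori ε')).symm.trans he
      rw [hs', hcongr ε' (G.bar (G.bar (G.ori ε'))) (G.ori ε') (G.bar_bar _).symm _
        (G.geom_ori ε') a, inv_mul_eq_iff_eq_mul, ← mul_assoc, eq_mul_inv_iff_mul_eq]
      exact (hσ ε' a).symm
  obtain ⟨τ, hτ, hτ'⟩ := hM.exists_potential s (fun e _ => hsbar e) Q (fun e he => by
    obtain ⟨ε, rfl | rfl⟩ := G.exists_ori_or_bar_ori e
    · rw [hs]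
      exact hQ ε he
    · rw [hs']
      refine Q.inv_mem (hQ ε ?_)
      have := hM.bar_mem _ he
      rwa [G.bar_bar] at this)
  have hτbar : ∀ e, τ (G.t (G.bar e)) = τ (G.o e) := fun e => by rw [G.t_bar]
  obtain ⟨Ψ, h1, h2⟩ := FundGroup.exists_lift 𝒢 M
    (fun v => (MulAut.conj (τ v)).toMonoidHom.comp (ρ v))
    (fun e => τ (G.o e) * s e * (τ (G.t e))⁻¹)
    (fun ε e he a => by
      have h := hsrel ε e he a
      simp only [MonoidHom.comp_apply, MulEquiv.toMonoidHom_eq_coe, MonoidHom.coe_coe,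
        MulAut.conj_apply, hτbar]
      rw [← eq_mul_inv_iff_mul_eq] at h
      rw [mul_inv_eq_one]
      calc _ = τ (G.o e) * (s e * ρ _ (𝒢.h ε e he a)) * (s e)⁻¹ * (τ (G.o e))⁻¹ := by group
        _ = _ := by rw [hsrel]; group)
    (fun e => by
      have h := hsbar e
      rw [hτbar, G.o_bar, eq_inv_of_mul_eq_one_right h]
      group)
    (fun e he => by rw [hτ' e he]; group)
  exact ⟨τ, Ψ, hτ, h1, fun ε => by rw [h2, hs]⟩

end GraphOfGroups

/-! ### The vertex groups embed into the fundamental group -/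

/-- The action of `A` on `K` by left translation through an embedding `α` is a disjoint union of copies
of the regular action, indexed by the cosets of `α(A)`. -/
theorem exists_equiv_quotient_prod {A K : Type*} [Group A] [Group K] (α : A →* K)
    (hα : Function.Injective α) :
    ∃ e : (K ⧸ α.range) × A ≃ K, ∀ q a b, e (q, a * b) = α a * e (q, b) := by
  -- Inverses of representatives of left cosets represent the right cosets, the orbits of `A`.
  refine ⟨Equiv.ofBijective (fun q => α q.2 * q.1.out⁻¹) ⟨?_, ?_⟩, fun q a b => ?_⟩
  · rintro ⟨q, a⟩ ⟨r, b⟩ h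
    have h' : q.out⁻¹ = α (a⁻¹ * b) * r.out⁻¹ := by
      simp only at h
      rw [map_mul, map_inv, mul_assoc, ← h, inv_mul_cancel_left]
    have hqr : q = r := by
      rw [← QuotientGroup.out_eq' q, ← QuotientGroup.out_eq' r]
      refine QuotientGroup.eq.2 ?_
      rw [h', inv_mul_cancel_right]
      exact ⟨_, rfl⟩
    subst hqr
    exact Prod.ext rfl (hα (mul_right_cancel h))
  · intro k
    obtain ⟨⟨_, a, rfl⟩, ha⟩ := QuotientGroup.mk_out_eq_mul α.range k⁻¹
    refine ⟨(QuotientGroup.mk k⁻¹, a), ?_⟩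
    simp only at ha ⊢
    rw [ha]
    simp
  · change α (a * b) * _ = α a * (α b * _)
    rw [map_mul, mul_assoc]

universe u in
/-- Two embeddings `α, β` of a group `A` into `K` become conjugate in the permutation group of
`K × Z`, for `Z` infinite and large: both actions of `A` are free with `|Z|` orbits. -/
theorem exists_perm_intertwining {A : Type*} {K Z : Type u} [Group A] [Group K] [Infinite Z]
    (hZ : Cardinal.mk K ≤ Cardinal.mk Z) (α β : A →* K) (hα : Function.Injective α)
    (hβ : Function.Injective β) :
    ∃ σ : Equiv.Perm (K × Z), ∀ a x, σ (α a * x.1, x.2) = (β a * (σ x).1, (σ x).2) := by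
  obtain ⟨e, he⟩ := exists_equiv_quotient_prod α hα
  obtain ⟨f, hf⟩ := exists_equiv_quotient_prod β hβ
  have key : ∀ H : Subgroup K, Nonempty ((K ⧸ H) × Z ≃ Z) := fun H => by
    rw [← Cardinal.eq, ← Cardinal.mul_def]
    exact Cardinal.mul_eq_right (Cardinal.aleph0_le_mk Z)
      ((Cardinal.mk_quotient_le).trans hZ) (Cardinal.mk_ne_zero _)
  obtain ⟨i⟩ := key α.range
  obtain ⟨j⟩ := key β.range
  let c : (K ⧸ α.range) × Z ≃ (K ⧸ β.range) × Z := i.trans j.symm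
  let swap : ∀ X : Type u, (X × A) × Z ≃ (X × Z) × A := fun X =>
    { toFun := fun x => ((x.1.1, x.2), x.1.2)
      invFun := fun x => ((x.1.1, x.2), x.1.2)
      left_inv := fun _ => rfl
      right_inv := fun _ => rfl }
  let E : ((K ⧸ α.range) × Z) × A ≃ K × Z :=
    (swap _).symm.trans (e.prodCongr (Equiv.refl Z))
  let F : ((K ⧸ β.range) × Z) × A ≃ K × Z :=
    (swap _).symm.trans (f.prodCongr (Equiv.refl Z))
  have hE : ∀ q a b, E (q, a * b) = (α a * (E (q, b)).1, (E (q, b)).2) :=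
    fun q a b => Prod.ext (he q.1 a b) rfl
  have hF : ∀ q a b, F (q, a * b) = (β a * (F (q, b)).1, (F (q, b)).2) :=
    fun q a b => Prod.ext (hf q.1 a b) rfl
  refine ⟨(E.symm.trans (c.prodCongr (Equiv.refl A))).trans F, fun a x => ?_⟩
  obtain ⟨⟨q, b⟩, rfl⟩ := E.surjective x
  rw [← hE]
  simp [hF]

namespace GraphOfGroups

variable {V E : Type*} {G : SerreGraph V E} (𝒢 : GraphOfGroups G) {M : Set E}

theorem vertexMap_injective (hM : G.IsMaximalTree M) (v : V) :
    Function.Injective (𝒢.vertexMap M v) := by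
  classical
  let K := ∀ v, 𝒢.vertexGroup v
  let Z := K ⊕ ULift ℕ
  have hZ : Cardinal.mk K ≤ Cardinal.mk Z := Cardinal.mk_le_of_injective Sum.inl_injective
  let ι : ∀ v, 𝒢.vertexGroup v →* K := fun v => MonoidHom.mulSingle _ v
  have hι : ∀ v, Function.Injective (ι v) := fun v => Pi.mulSingle_injective v
  let R : K →* Equiv.Perm (K × Z) :=
    { toFun := fun k => (Equiv.mulLeft k).prodCongr (Equiv.refl Z)
      map_one' := by ext x <;> simp
      map_mul' := fun a b => by ext x <;> simp [mul_assoc] }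
  have hR : Function.Injective R := fun a b h => by
    have := congrArg Prod.fst (Equiv.congr_fun h ((1 : K), Sum.inl 1))
    simpa [R] using this
  choose σ hσ using fun ε : G.GeomEdge => exists_perm_intertwining hZ
    ((ι _).comp (𝒢.h ε (G.ori ε) (G.geom_ori ε)))
    ((ι _).comp (𝒢.h ε (G.bar (G.ori ε)) ((G.geom_bar _).trans (G.geom_ori ε))))
    ((hι _).comp (𝒢.h_injective _ _ _)) ((hι _).comp (𝒢.h_injective _ _ _))
  obtain ⟨τ, Ψ, -, h1, -⟩ := FundGroup.exists_hom_of_edge_data 𝒢 hM (fun v => R.comp (ι v)) σ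
    (fun ε a => Equiv.ext fun x => hσ ε a x) ⊤ (fun _ _ => trivial)
  intro a b hab
  have h := congrArg Ψ hab
  rw [h1, h1] at h
  exact hι v (hR (mul_left_cancel (mul_right_cancel h)))

/-! ### The action on the Bass–Serre tree -/

instance : MulAction (𝒢.FundGroup M) (𝒢.TreeVertex M) :=
  inferInstanceAs (MulAction (𝒢.FundGroup M) (Σ v : V, 𝒢.FundGroup M ⧸ 𝒢.vertexSubgroup M v))

instance : MulAction (𝒢.FundGroup M) (𝒢.TreeEdge M) :=
  inferInstanceAs (MulAction (𝒢.FundGroup M)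
    (Σ ε : G.GeomEdge, 𝒢.FundGroup M ⧸ 𝒢.edgeSubgroup M (G.ori ε)))

theorem smul_vtx (a g : 𝒢.FundGroup M) (v : V) : a • 𝒢.vtx M v g = 𝒢.vtx M v (a * g) := rfl

theorem smul_edg (a g : 𝒢.FundGroup M) (ε : G.GeomEdge) :
    a • 𝒢.edg M ε g = 𝒢.edg M ε (a * g) := rfl

theorem vtx_surjective (w : 𝒢.TreeVertex M) : ∃ v g, w = 𝒢.vtx M v g := by
  obtain ⟨v, c⟩ := w
  obtain ⟨g, rfl⟩ := QuotientGroup.mk_surjective c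
  exact ⟨v, g, rfl⟩

theorem edg_surjective (η : 𝒢.TreeEdge M) : ∃ ε g, η = 𝒢.edg M ε g := by
  obtain ⟨ε, c⟩ := η
  obtain ⟨g, rfl⟩ := QuotientGroup.mk_surjective c
  exact ⟨ε, g, rfl⟩

theorem vtx_eq_vtx_iff {v : V} {g g' : 𝒢.FundGroup M} :
    𝒢.vtx M v g = 𝒢.vtx M v g' ↔ ∃ γ, g' = g * 𝒢.vertexMap M v γ := by
  constructor
  · intro h
    obtain ⟨γ, hγ⟩ := QuotientGroup.eq.1 (eq_of_heq (Sigma.mk.inj h).2)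
    exact ⟨γ, by rw [hγ, mul_inv_cancel_left]⟩
  · rintro ⟨γ, rfl⟩
    exact congrArg (Sigma.mk v) (QuotientGroup.eq.2 ⟨γ, by group⟩)

theorem vtx_mul_vertexMap (v : V) (g : 𝒢.FundGroup M) (γ : 𝒢.vertexGroup v) :
    𝒢.vtx M v (g * 𝒢.vertexMap M v γ) = 𝒢.vtx M v g :=
  (𝒢.vtx_eq_vtx_iff.2 ⟨γ, rfl⟩).symm

theorem mem_edgeSubgroup_iff {ε : G.GeomEdge} {e : E} (he : G.geom e = ε) {x : 𝒢.FundGroup M} :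
    x ∈ 𝒢.edgeSubgroup M e ↔ ∃ a, 𝒢.vertexMap M _ (𝒢.h ε e he a) = x := by
  subst he
  rfl

theorem edg_eq_edg_iff {ε : G.GeomEdge} {g g' : 𝒢.FundGroup M} :
    𝒢.edg M ε g = 𝒢.edg M ε g' ↔
      ∃ a, g' = g * 𝒢.vertexMap M _ (𝒢.h ε (G.ori ε) (G.geom_ori ε) a) := by
  constructor
  · intro h
    obtain ⟨a, ha⟩ := (𝒢.mem_edgeSubgroup_iff (G.geom_ori ε)).1
      (QuotientGroup.eq.1 (eq_of_heq (Sigma.mk.inj h).2))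
    exact ⟨a, by rw [ha, mul_inv_cancel_left]⟩
  · rintro ⟨a, rfl⟩
    exact congrArg (Sigma.mk ε) (QuotientGroup.eq.2
      ((𝒢.mem_edgeSubgroup_iff (G.geom_ori ε)).2 ⟨a, by group⟩))

/-- The elements `h_e(a)` of the edge group fix the origin of the edge. -/
theorem vtx_origin_mul_edge (ε : G.GeomEdge) (g : 𝒢.FundGroup M) (a : 𝒢.edgeGroup ε) :
    𝒢.vtx M (G.o (G.ori ε)) (g * 𝒢.vertexMap M _ (𝒢.h ε (G.ori ε) (G.geom_ori ε) a) *
      (𝒢.edgeElt M (G.ori ε))⁻¹) = 𝒢.vtx M (G.o (G.ori ε)) (g * (𝒢.edgeElt M (G.ori ε))⁻¹) := by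
  have h := 𝒢.edge_relation M ε (G.ori ε) (G.geom_ori ε) a
  have h' : g * 𝒢.vertexMap M _ (𝒢.h ε (G.ori ε) (G.geom_ori ε) a) * (𝒢.edgeElt M (G.ori ε))⁻¹ =
      g * (𝒢.edgeElt M (G.ori ε))⁻¹ * 𝒢.vertexMap M _ (𝒢.h ε (G.bar (G.ori ε))
        ((G.geom_bar _).trans (G.geom_ori ε)) a) := by
    rw [← h]
    group
  rw [h', G.o_eq, vtx_mul_vertexMap]

/-- Incidence can be read off from any representative of an edge. -/
theorem incident_edg_iff {w : 𝒢.TreeVertex M} {ε : G.GeomEdge} {g : 𝒢.FundGroup M} :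
    𝒢.Incident M w (𝒢.edg M ε g) ↔ w = 𝒢.vtx M (G.t (G.ori ε)) g ∨
      w = 𝒢.vtx M (G.o (G.ori ε)) (g * (𝒢.edgeElt M (G.ori ε))⁻¹) := by
  refine ⟨?_, fun h => ⟨ε, g, rfl, h⟩⟩
  rintro ⟨ε', g', h, h'⟩
  obtain rfl : ε = ε' := (Sigma.mk.inj h).1
  obtain ⟨a, rfl⟩ := 𝒢.edg_eq_edg_iff.1 h
  rwa [vtx_mul_vertexMap, vtx_origin_mul_edge] at h'

theorem Incident.smul {w : 𝒢.TreeVertex M} {η : 𝒢.TreeEdge M} (h : 𝒢.Incident M w η)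
    (a : 𝒢.FundGroup M) : 𝒢.Incident M (a • w) (a • η) := by
  obtain ⟨ε, g, rfl, h⟩ := h
  rw [smul_edg, incident_edg_iff]
  refine h.imp ?_ ?_ <;> rintro rfl
  · rfl
  · rw [smul_vtx, mul_assoc]

/-- An element of the fundamental group as a self-map of the subdivided Bass–Serre tree. -/
def subdivisionHom (a : 𝒢.FundGroup M) : 𝒢.subdivision M →g 𝒢.subdivision M where
  toFun x := a • x
  map_rel' := by
    rintro (w | η) (w' | η') h
    · exact h.elim
    · exact Incident.smul 𝒢 h a
    · exact Incident.smul 𝒢 h a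
    · exact h.elim

@[simp] theorem subdivisionHom_apply (a : 𝒢.FundGroup M) (x : 𝒢.TreeVertex M ⊕ 𝒢.TreeEdge M) :
    𝒢.subdivisionHom a x = a • x := rfl

/-! ### The Bass–Serre tree is a forest -/

/-- There is an integer-valued function of vertices and edges of `T` which, for every fixed edge `η`,
is constant across all edges other than `η` and jumps by one across `η`.

With `W = ℤ^{E(T)}`, such functions are `F : V(T) → W`. Let `Γ` act on `W` by affine
transformations, with linear part the permutation action: vertex groups act linearly, and the
edge `e` acts by `x ↦ e(x + [Γ_e])`, up to conjugation by translations `τ_v`. Then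
`F(gΓ_v) = g(τ_v(0))` has the required property. -/
theorem exists_edge_separating (hM : G.IsMaximalTree M) :
    ∃ F : 𝒢.TreeVertex M → 𝒢.TreeEdge M → ℤ, ∀ ε g,
      (∀ η, η ≠ 𝒢.edg M ε g → F (𝒢.vtx M (G.t (G.ori ε)) g) η =
        F (𝒢.vtx M (G.o (G.ori ε)) (g * (𝒢.edgeElt M (G.ori ε))⁻¹)) η) ∧
      F (𝒢.vtx M (G.t (G.ori ε)) g) (𝒢.edg M ε g) =
        F (𝒢.vtx M (G.o (G.ori ε)) (g * (𝒢.edgeElt M (G.ori ε))⁻¹)) (𝒢.edg M ε g) + 1 := by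
  classical
  let W := 𝒢.TreeEdge M → ℤ
  let A : 𝒢.FundGroup M →* Equiv.Perm W :=
    { toFun := fun g =>
        { toFun := fun f η => f (g⁻¹ • η)
          invFun := fun f η => f (g • η)
          left_inv := fun f => by funext η; simp
          right_inv := fun f => by funext η; simp }
      map_one' := by ext f η; simp
      map_mul' := fun a b => by ext f η; simp [mul_smul] }
  have hA : ∀ g f η, A g f η = f (g⁻¹ • η) := fun _ _ _ => rfl
  let T : Multiplicative W →* Equiv.Perm W :=
    { toFun := fun x => Equiv.addLeft x.toAdd
      map_one' := by ext; simp
      map_mul' := fun a b => by ext; simp }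
  have hT : ∀ x y, T x y = x.toAdd + y := fun _ _ => rfl
  let u : G.GeomEdge → W := fun ε => Pi.single (𝒢.edg M ε 1) 1
  have hu : ∀ ε a, A (𝒢.vertexMap M _ (𝒢.h ε (G.ori ε) (G.geom_ori ε) a)) (u ε) = u ε := by
    intro ε a
    funext η
    have : 𝒢.vertexMap M _ (𝒢.h ε (G.ori ε) (G.geom_ori ε) a) • 𝒢.edg M ε 1 = 𝒢.edg M ε 1 :=
      (𝒢.edg_eq_edg_iff.2 ⟨a, (mul_one _).trans (one_mul _).symm⟩).symm
    simp only [hA, u, Pi.single_apply, inv_smul_eq_iff, this]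
  have hinv : ∀ (f : Equiv.Perm W) x, f⁻¹ (f x) = x := fun f x => f.symm_apply_apply x
  have hadd : ∀ g x y, A g (x + y) = A g x + A g y := fun _ _ _ => rfl
  obtain ⟨τ, Ψ, hτ, hΨ, hΨ'⟩ := FundGroup.exists_hom_of_edge_data 𝒢 hM
    (fun v => A.comp (𝒢.vertexMap M v))
    (fun ε => A (𝒢.edgeElt M (G.ori ε)) * T (Multiplicative.ofAdd (u ε)))
    (fun ε a => by
      simp only [MonoidHom.comp_apply]
      rw [← 𝒢.edge_relation M ε (G.ori ε) (G.geom_ori ε) a, ← mul_assoc (A _) (A _), ← map_mul,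
        inv_mul_cancel_right, map_mul, mul_assoc, mul_assoc]
      congr 1
      ext1 x
      simp only [Equiv.Perm.mul_apply, hT, hadd, hu, toAdd_ofAdd])
    -- Along `M` the edge elements are trivial, so `σ` and the potential consist of translations.
    T.range
    (fun ε hε => by
      rw [𝒢.edgeElt_of_mem M hε, map_one, one_mul]
      exact ⟨_, rfl⟩)
  choose c hc using hτ
  -- The linear part of `Ψ g` is the permutation action of `g`.
  have hlin : ∀ g x y, Ψ g x - Ψ g y = A g (x - y) := by
    intro g
    have hsub : ∀ g x y, A g (x - y) = A g x - A g y := fun _ _ _ => rfl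
    induction g using FundGroup.induction with
    | one => simp
    | vertex v γ =>
      intro x y
      rw [hΨ, ← hc, ← map_inv]
      simp only [Equiv.Perm.mul_apply, hT, MonoidHom.comp_apply, hsub, hadd]
      abel
    | edge ε =>
      intro x y
      rw [hΨ', ← hc, ← hc, ← map_inv]
      simp only [Equiv.Perm.mul_apply, hT, hsub, hadd]
      abel
    | inv g ih =>
      intro x y
      have := ih (Ψ g⁻¹ x) (Ψ g⁻¹ y)
      rw [← Equiv.Perm.mul_apply, ← Equiv.Perm.mul_apply, ← map_mul, mul_inv_cancel, map_one,
        Equiv.Perm.one_apply, Equiv.Perm.one_apply] at this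
      rw [this, ← Equiv.Perm.mul_apply, ← map_mul, inv_mul_cancel, map_one, Equiv.Perm.one_apply]
    | mul a b iha ihb =>
      intro x y
      rw [map_mul, map_mul, Equiv.Perm.mul_apply, Equiv.Perm.mul_apply, Equiv.Perm.mul_apply, iha,
        ihb]
  have hA0 : ∀ g, A g 0 = 0 := fun g => rfl
  let F : 𝒢.TreeVertex M → W := fun w => Quotient.liftOn' w.2 (fun g => Ψ g (τ w.1 0)) (by
    intro a b hab
    rw [QuotientGroup.leftRel_apply] at hab
    obtain ⟨γ, hγ⟩ := hab
    have hb : b = a * 𝒢.vertexMap M w.1 γ := by rw [hγ, mul_inv_cancel_left]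
    simp only [hb, map_mul, hΨ, Equiv.Perm.mul_apply, hinv,
      MonoidHom.comp_apply, hA0])
  have hF : ∀ v g, F (𝒢.vtx M v g) = Ψ g (τ v 0) := fun _ _ => rfl
  -- The jump of `F` across `gΓ_e` is the basis vector `g[Γ_e]`.
  have key : ∀ ε g, F (𝒢.vtx M (G.t (G.ori ε)) g) -
      F (𝒢.vtx M (G.o (G.ori ε)) (g * (𝒢.edgeElt M (G.ori ε))⁻¹)) = A g (u ε) := by
    intro ε g
    rw [hF, hF, map_mul, Equiv.Perm.mul_apply, hlin, map_inv, hΨ']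
    congr 1
    simp only [mul_inv_rev, inv_inv, Equiv.Perm.mul_apply, hinv]
    rw [← map_inv A, hA0, ← map_inv T, ← hc, hT, hT, hT]
    simp only [toAdd_inv, toAdd_ofAdd, add_zero, sub_add_cancel_left]
    exact neg_neg (u ε)
  refine ⟨F, fun ε g => ⟨fun η hη => ?_, ?_⟩⟩
  · have := congrFun (key ε g) η
    rw [Pi.sub_apply, hA] at this
    rw [← sub_eq_zero, this]
    refine Pi.single_eq_of_ne ?_ _
    rw [Ne, inv_smul_eq_iff, smul_edg, mul_one]
    exact hη
  · have := congrFun (key ε g) (𝒢.edg M ε g)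
    rw [Pi.sub_apply, hA, smul_edg, inv_mul_cancel] at this
    have h1 : u ε (𝒢.edg M ε 1) = 1 := Pi.single_eq_same _ _
    rw [h1] at this
    linarith

/-- The Bass–Serre tree has no loops. -/
theorem vtx_terminus_ne_vtx_origin (hM : G.IsMaximalTree M) (ε : G.GeomEdge)
    (g : 𝒢.FundGroup M) : 𝒢.vtx M (G.t (G.ori ε)) g ≠
      𝒢.vtx M (G.o (G.ori ε)) (g * (𝒢.edgeElt M (G.ori ε))⁻¹) := by
  intro h
  obtain ⟨F, hF⟩ := 𝒢.exists_edge_separating hM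
  have := (hF ε g).2
  rw [← h] at this
  linarith

theorem subdivision_isAcyclic (hM : G.IsMaximalTree M) : (𝒢.subdivision M).IsAcyclic := by
  classical
  obtain ⟨F, hF⟩ := 𝒢.exists_edge_separating hM
  have hconst : ∀ η η' w w', 𝒢.Incident M w η' → 𝒢.Incident M w' η' → η ≠ η' →
      F w η = F w' η := by
    intro η η' w w' hw hw' hne
    obtain ⟨ε, g, rfl⟩ := 𝒢.edg_surjective η'
    have := (hF ε g).1 η hne
    rcases 𝒢.incident_edg_iff.1 hw with rfl | rfl <;>
      rcases 𝒢.incident_edg_iff.1 hw' with rfl | rfl <;> simp [this]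
  have hother : ∀ η w, 𝒢.Incident M w η → ∃ w', F w η ≠ F w' η ∧
      ∀ w'', 𝒢.Incident M w'' η → w'' = w ∨ w'' = w' := by
    intro η w hw
    obtain ⟨ε, g, rfl⟩ := 𝒢.edg_surjective η
    have := (hF ε g).2
    rcases 𝒢.incident_edg_iff.1 hw with rfl | rfl
    · exact ⟨_, by rw [this]; simp, fun w'' h => 𝒢.incident_edg_iff.1 h⟩
    · exact ⟨_, by rw [this]; simp, fun w'' h => (𝒢.incident_edg_iff.1 h).symm⟩
  have hex : ∀ η : 𝒢.TreeEdge M, ∃ w, 𝒢.Incident M w η := by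
    intro η
    obtain ⟨ε, g, rfl⟩ := 𝒢.edg_surjective η
    exact ⟨_, 𝒢.incident_edg_iff.2 (Or.inl rfl)⟩
  choose pick hpick using hex
  have hbridge : ∀ w η, 𝒢.Incident M w η →
      (𝒢.subdivision M).IsBridge s(Sum.inl w, Sum.inr η) := by
    intro w η hw
    obtain ⟨w', hne, hw'⟩ := hother η w hw
    -- Once `w η` is removed, the value at the other end `w'` of `η` extends to `η`.
    let φ : 𝒢.TreeVertex M ⊕ 𝒢.TreeEdge M → ℤ :=
      Sum.elim (fun w => F w η) fun η' => if η' = η then F w' η else F (pick η') η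
    have hφ : ∀ w₁ η₁, 𝒢.Incident M w₁ η₁ → ¬ (w₁ = w ∧ η₁ = η) →
        φ (Sum.inl w₁) = φ (Sum.inr η₁) := by
      intro w₁ η₁ h hn
      by_cases hη : η₁ = η
      · subst hη
        simp only [φ, Sum.elim_inl, Sum.elim_inr, if_true]
        rcases hw' w₁ h with rfl | rfl
        · exact (hn ⟨rfl, rfl⟩).elim
        · rfl
      · simp only [φ, Sum.elim_inl, Sum.elim_inr, if_neg hη]
        exact hconst η η₁ _ _ h (hpick _) (Ne.symm hη)
    have hwalk : ∀ {a b}, ((𝒢.subdivision M).deleteEdges {s(Sum.inl w, Sum.inr η)}).Walk a b →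
        φ a = φ b := by
      intro a b P
      induction P with
      | nil => rfl
      | @cons a b c h P ih =>
        rw [← ih]
        rw [SimpleGraph.deleteEdges_adj] at h
        obtain ⟨h, hn⟩ := h
        rcases a with a | a <;> rcases b with b | b
        · exact h.elim
        · exact hφ a b h (by rintro ⟨rfl, rfl⟩; exact hn rfl)
        · exact (hφ b a h (by rintro ⟨rfl, rfl⟩; exact hn Sym2.eq_swap)).symm
        · exact h.elim
    rw [SimpleGraph.isBridge_iff]
    rintro ⟨P⟩
    have := hwalk P
    simp only [φ, Sum.elim_inl, Sum.elim_inr, if_true] at this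
    exact hne this
  rw [SimpleGraph.isAcyclic_iff_forall_adj_isBridge]
  rintro (a | a) (b | b) h
  · exact h.elim
  · exact hbridge a b h
  · rw [Sym2.eq_swap]
    exact hbridge b a h
  · exact h.elim

/-! ### The Bass–Serre tree is connected -/

theorem reachable_ends (ε : G.GeomEdge) (g : 𝒢.FundGroup M) :
    (𝒢.subdivision M).Reachable (Sum.inl (𝒢.vtx M (G.t (G.ori ε)) g))
      (Sum.inl (𝒢.vtx M (G.o (G.ori ε)) (g * (𝒢.edgeElt M (G.ori ε))⁻¹))) := by
  have h1 : (𝒢.subdivision M).Adj (Sum.inl (𝒢.vtx M (G.t (G.ori ε)) g))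
    (Sum.inr (𝒢.edg M ε g)) := 𝒢.incident_edg_iff.2 (Or.inl rfl)
  have h2 : (𝒢.subdivision M).Adj (Sum.inr (𝒢.edg M ε g))
      (Sum.inl (𝒢.vtx M (G.o (G.ori ε)) (g * (𝒢.edgeElt M (G.ori ε))⁻¹))) :=
    𝒢.incident_edg_iff.2 (Or.inr rfl)
  exact h1.reachable.trans h2.reachable

theorem reachable_smul {x y : 𝒢.TreeVertex M ⊕ 𝒢.TreeEdge M} (a : 𝒢.FundGroup M)
    (h : (𝒢.subdivision M).Reachable x y) : (𝒢.subdivision M).Reachable (a • x) (a • y) :=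
  h.map (𝒢.subdivisionHom a)

/-- The vertices `Γ_v` of the lift of the maximal tree `M` are connected to each other. -/
theorem reachable_vtx_one (hM : G.IsMaximalTree M) (v v' : V) :
    (𝒢.subdivision M).Reachable (Sum.inl (𝒢.vtx M v 1)) (Sum.inl (𝒢.vtx M v' 1)) := by
  have hedge : ∀ e ∈ M, (𝒢.subdivision M).Reachable (Sum.inl (𝒢.vtx M (G.t e) 1))
      (Sum.inl (𝒢.vtx M (G.o e) 1)) := by
    intro e he
    obtain ⟨ε, rfl | rfl⟩ := G.exists_ori_or_bar_ori e
    · have := 𝒢.reachable_ends (M := M) ε 1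
      rwa [𝒢.edgeElt_of_mem M he, inv_one, mul_one] at this
    · have := 𝒢.reachable_ends (M := M) ε 1
      rw [← G.bar_bar (G.ori ε), 𝒢.edgeElt_of_mem M (hM.bar_mem _ he), G.bar_bar, inv_one,
        mul_one] at this
      rw [G.t_bar, G.o_bar]
      exact this.symm
  obtain ⟨P⟩ := hM.isTree.connected.preconnected v v'
  induction P with
  | nil => exact .rfl
  | cons h P ih =>
    refine .trans ?_ ih
    rcases h.2 with ⟨e, he, rfl, rfl⟩ | ⟨e, he, rfl, rfl⟩
    · exact (hedge e he).symm
    · exact hedge e he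

theorem subdivision_connected (hM : G.IsMaximalTree M) : (𝒢.subdivision M).Connected := by
  obtain ⟨v₀⟩ := hM.isTree.connected.nonempty
  have key : ∀ (g : 𝒢.FundGroup M) (v v' : V), (𝒢.subdivision M).Reachable
      (Sum.inl (𝒢.vtx M v 1)) (Sum.inl (𝒢.vtx M v' g)) := by
    have hone : ∀ (g : 𝒢.FundGroup M) (v v' : V), (𝒢.subdivision M).Reachable
        (Sum.inl (𝒢.vtx M v g)) (Sum.inl (𝒢.vtx M v' g)) := fun g v v' => by
      simpa [smul_vtx] using 𝒢.reachable_smul g (𝒢.reachable_vtx_one hM v v')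
    have hsome : ∀ (g : 𝒢.FundGroup M) (v v' : V), (𝒢.subdivision M).Reachable
        (Sum.inl (𝒢.vtx M v 1)) (Sum.inl (𝒢.vtx M v' g)) → ∀ u u',
        (𝒢.subdivision M).Reachable (Sum.inl (𝒢.vtx M u 1)) (Sum.inl (𝒢.vtx M u' g)) :=
      fun g v v' h u u' => (hone 1 u v).trans (h.trans (hone g v' u'))
    intro g
    induction g using FundGroup.induction with
    | one => exact hone 1
    | vertex v γ =>
      refine hsome _ v v ?_
      rw [← one_mul (𝒢.vertexMap M v γ), vtx_mul_vertexMap]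
    | edge ε =>
      refine hsome _ (G.o (G.ori ε)) (G.t (G.ori ε)) ?_
      have := 𝒢.reachable_ends ε (𝒢.edgeElt M (G.ori ε))
      rw [mul_inv_cancel] at this
      exact this.symm
    | inv g ih =>
      refine hsome _ v₀ v₀ ?_
      simpa [smul_vtx] using (𝒢.reachable_smul g⁻¹ (ih v₀ v₀)).symm
    | mul a b iha ihb =>
      intro v v'
      refine (iha v v).trans ?_
      simpa [smul_vtx] using 𝒢.reachable_smul a (ihb v v')
  rw [SimpleGraph.connected_iff_exists_forall_reachable]
  refine ⟨Sum.inl (𝒢.vtx M v₀ 1), ?_⟩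
  rintro (w | η)
  · obtain ⟨v, g, rfl⟩ := 𝒢.vtx_surjective w
    exact key g v₀ v
  · obtain ⟨ε, g, rfl⟩ := 𝒢.edg_surjective η
    have h : (𝒢.subdivision M).Adj (Sum.inl (𝒢.vtx M (G.t (G.ori ε)) g))
      (Sum.inr (𝒢.edg M ε g)) := 𝒢.incident_edg_iff.2 (Or.inl rfl)
    exact (key g _ _).trans h.reachable

theorem subdivision_isTree (hM : G.IsMaximalTree M) : (𝒢.subdivision M).IsTree :=
  ⟨𝒢.subdivision_connected hM, 𝒢.subdivision_isAcyclic hM⟩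

end GraphOfGroups

/-! ### Branches of a tree at a vertex -/

section Toward

variable {X : Type*} {S : SimpleGraph X} (hS : S.IsTree)

/-- The first vertex after `w` on the path from `w` to `y` in a tree; it is `w` itself if `y = w`.
For `y ≠ w` it labels the branch at `w`, i.e. the component of the complement of `w`, that
contains `y`. -/
def toward (w y : X) : X := (hS.existsUnique_path w y).choose.snd

theorem snd_eq_toward {w y : X} {P : S.Walk w y} (hP : P.IsPath) : P.snd = toward hS w y :=
  congrArg SimpleGraph.Walk.snd ((hS.existsUnique_path w y).choose_spec.2 P hP)

theorem toward_self (w : X) : toward hS w w = w :=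
  (snd_eq_toward hS SimpleGraph.Walk.IsPath.nil).symm

theorem exists_cons_isPath {w y : X} (h : y ≠ w) :
    ∃ (hadj : S.Adj w (toward hS w y)) (P : S.Walk (toward hS w y) y), (P.cons hadj).IsPath := by
  obtain ⟨P, hP, -⟩ := hS.existsUnique_path w y
  cases P with
  | nil => exact (h rfl).elim
  | @cons _ z _ hadj P =>
    obtain rfl : z = toward hS w y := by simpa using snd_eq_toward hS hP
    exact ⟨hadj, P, hP⟩

theorem adj_toward {w y : X} (h : y ≠ w) : S.Adj w (toward hS w y) :=
  (exists_cons_isPath hS h).1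

theorem toward_of_adj {w y : X} (h : S.Adj w y) : toward hS w y = y := by
  rw [← snd_eq_toward hS (SimpleGraph.Walk.IsPath.of_adj h)]
  simp

theorem toward_eq_of_mem_support {w y z : X} {P : S.Walk w y} (hP : P.IsPath)
    (hz : z ∈ P.support) (hzw : z ≠ w) : toward hS w z = toward hS w y := by
  classical
  rw [← snd_eq_toward hS hP, ← snd_eq_toward hS (hP.takeUntil hz),
    SimpleGraph.Walk.snd_takeUntil hzw]

theorem toward_eq_of_adj {w y z : X} (h : S.Adj y z) (hy : y ≠ w) (hz : z ≠ w) :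
    toward hS w y = toward hS w z := by
  obtain ⟨P, hP, -⟩ := hS.existsUnique_path w y
  obtain ⟨Q, hQ, -⟩ := hS.existsUnique_path w z
  by_cases hv : y ∈ Q.support
  · exact toward_eq_of_mem_support hS hQ hv hy
  · exact (toward_eq_of_mem_support hS hP
      (hS.isAcyclic.mem_support_of_ne_mem_support_of_adj_of_isPath hP hQ h hv) hz).symm

theorem toward_eq_of_notMem_support {w y z : X} (P : S.Walk y z) (hw : w ∉ P.support) :
    toward hS w y = toward hS w z := by
  induction P with
  | nil => rfl
  | @cons a b c h P ih =>
    rw [SimpleGraph.Walk.support_cons, List.mem_cons, not_or] at hw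
    rw [← ih hw.2]
    exact toward_eq_of_adj hS h (Ne.symm hw.1)
      (fun hb => hw.2 (hb ▸ P.start_mem_support))

theorem connectedComponentMk_eq_iff_toward_eq {w y z : X} (hy : y ∈ ({w}ᶜ : Set X))
    (hz : z ∈ ({w}ᶜ : Set X)) :
    (S.induce {w}ᶜ).connectedComponentMk ⟨y, hy⟩ = (S.induce {w}ᶜ).connectedComponentMk ⟨z, hz⟩ ↔
      toward hS w y = toward hS w z := by
  rw [SimpleGraph.ConnectedComponent.eq]
  constructor
  · have key : ∀ {a b : ({w}ᶜ : Set X)}, (S.induce {w}ᶜ).Walk a b →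
        toward hS w a = toward hS w b := by
      intro a b P
      induction P with
      | nil => rfl
      | @cons a b c h P ih => exact (toward_eq_of_adj hS h a.2 b.2).trans ih
    rintro ⟨P⟩
    exact key P
  · intro h
    have key : ∀ y (hy : y ≠ w), ∃ h, (S.induce {w}ᶜ).Reachable ⟨toward hS w y, h⟩ ⟨y, hy⟩ := by
      intro y hy
      obtain ⟨hadj, P, hP⟩ := exists_cons_isPath hS hy
      exact ⟨hadj.ne', ⟨P.induce _ <| by
        rintro x hx rfl
        exact ((SimpleGraph.Walk.cons_isPath_iff _ _).1 hP).2 hx⟩⟩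
    obtain ⟨h1, h2⟩ := key y hy
    obtain ⟨h3, h4⟩ := key z hz
    refine h2.symm.trans (.trans ?_ h4)
    simp only [h]
    exact .rfl

/-- A vertex `y` outside the branch at `w` containing `w'` lies, seen from `w'`, in the branch
containing `w`. -/
theorem toward_eq_of_toward_ne {w w' y : X} (hw : w' ≠ w)
    (h : toward hS w y ≠ toward hS w w') :
    y ≠ w' ∧ toward hS w' y = toward hS w' w := by
  refine ⟨fun hy => h (hy ▸ rfl), ?_⟩
  obtain ⟨P, hP, -⟩ := hS.existsUnique_path w y
  exact (toward_eq_of_notMem_support hS P fun hmem =>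
    h (toward_eq_of_mem_support hS hP hmem hw).symm).symm

theorem map_toward (f : S →g S) (hf : Function.Injective f) (w y : X) :
    f (toward hS w y) = toward hS (f w) (f y) := by
  obtain ⟨P, hP, -⟩ := hS.existsUnique_path w y
  rw [← snd_eq_toward hS hP, ← snd_eq_toward hS (hP.map hf)]
  exact (SimpleGraph.Walk.getVert_map _ _ _).symm

end Toward

/-! ### Alternating cochains -/

section Cochains

variable {Γ S : Type*} [Group Γ] [MulAction Γ S] {n : ℕ}

theorem AltCochain.eval_add (f f' : AltCochain Γ S n) (x : Fin (n + 1) → S) :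
    (f + f').eval x = f.eval x + f'.eval x := rfl

theorem AltCochain.eval_real_smul (c : ℝ) (f : AltCochain Γ S n) (x : Fin (n + 1) → S) :
    (c • f).eval x = c * f.eval x := rfl

theorem AltCochain.eval_delta (f : AltCochain Γ S n) (x : Fin (n + 2) → S) :
    (delta Γ S n f).eval x = ∑ i : Fin (n + 2), (-1 : ℝ) ^ (i : ℕ) * f.eval (x ∘ i.succAbove) :=
  rfl

theorem AltCochain.norm_le {f : AltCochain Γ S n} {C : ℝ} (hC : 0 ≤ C)
    (h : ∀ x, |f.eval x| ≤ C) : ‖f‖ ≤ C :=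
  lp.norm_le_of_forall_le hC h

theorem AltCochain.eval_eq_zero (f : AltCochain Γ S n) {x : Fin (n + 1) → S} {i j} (hij : i ≠ j)
    (h : x i = x j) : f.eval x = 0 := by
  have h1 := f.eval_perm (Equiv.swap i j) x
  have h2 : x ∘ Equiv.swap i j = x := 
    funext (Equiv.apply_swap_eq_self h)
  rw [h2, Equiv.Perm.sign_swap hij] at h1
  push_cast at h1
  linarith

/-- If two entries of a tuple agree, the two terms of the coboundary that omit one of them
cancel. -/
theorem AltCochain.eval_succAbove_cancel (f : AltCochain Γ S n) {x : Fin (n + 2) → S} {i j}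
    (hij : i ≠ j) (h : x i = x j) :
    (-1 : ℝ) ^ (i : ℕ) * f.eval (x ∘ i.succAbove) +
      (-1 : ℝ) ^ (j : ℕ) * f.eval (x ∘ j.succAbove) = 0 := by
  obtain ⟨ρ, h1, h2⟩ := exists_perm_succAbove (Equiv.swap i j) i
  rw [Equiv.swap_apply_left] at h1 h2
  have h3 : x ∘ Equiv.swap i j = x := 
    funext (Equiv.apply_swap_eq_self h)
  have h4 : x ∘ i.succAbove = (x ∘ j.succAbove) ∘ ρ := by
    funext k
    rw [Function.comp_apply, Function.comp_apply, Function.comp_apply, ← h1]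
    exact (congrFun h3 _).symm
  rw [h4, f.eval_perm, ← mul_assoc, h2, Equiv.Perm.sign_swap hij]
  push_cast
  ring

end Cochains

namespace GraphOfGroups

variable {V E : Type*} {G : SerreGraph V E} (𝒢 : GraphOfGroups G) {M : Set E}

/-! ### Barycenters -/

theorem isBarycenter_iff (hM : G.IsMaximalTree M) {n : ℕ} {w : 𝒢.TreeVertex M}
    {y : Fin (n + 1) → 𝒢.TreeVertex M ⊕ 𝒢.TreeEdge M} :
    𝒢.IsBarycenter M w y ↔ ∀ i j, i ≠ j → y i ≠ Sum.inl w → y j ≠ Sum.inl w →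
      toward (𝒢.subdivision_isTree hM) (Sum.inl w) (y i) ≠
        toward (𝒢.subdivision_isTree hM) (Sum.inl w) (y j) := by
  refine forall₃_congr fun i j _ => forall₂_congr fun hi hj => ?_
  rw [Ne, connectedComponentMk_eq_iff_toward_eq (𝒢.subdivision_isTree hM) hi hj]

/-- A tuple of at least three points has at most one barycenter: seen from a barycenter, at most one
of the points lies in the branch of any other vertex `w'`, and the remaining points all lie in
one branch at `w'`. -/
theorem IsBarycenter.unique (hM : G.IsMaximalTree M) {n : ℕ} (hn : 2 ≤ n)
    {w w' : 𝒢.TreeVertex M} {y : Fin (n + 1) → 𝒢.TreeVertex M ⊕ 𝒢.TreeEdge M}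
    (h : 𝒢.IsBarycenter M w y) (h' : 𝒢.IsBarycenter M w' y) : w = w' := by
  by_contra hne
  have hS := 𝒢.subdivision_isTree hM
  rw [isBarycenter_iff 𝒢 hM] at h h'
  have hne' : (Sum.inl w' : 𝒢.TreeVertex M ⊕ 𝒢.TreeEdge M) ≠ Sum.inl w :=
    fun e => hne (Sum.inl_injective e).symm
  -- At most one entry lies in the branch of `w'` at `w`, and at most one lies outside of it.
  have h1 : ∀ i j, i ≠ j →
      toward hS (Sum.inl w) (y i) = toward hS (Sum.inl w) (Sum.inl w') →
      toward hS (Sum.inl w) (y j) ≠ toward hS (Sum.inl w) (Sum.inl w') := by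
    have hw : ∀ i, toward hS (Sum.inl w) (y i) = toward hS (Sum.inl w) (Sum.inl w') →
        y i ≠ Sum.inl w := by
      intro i hi hyi
      rw [hyi, toward_self] at hi
      exact (adj_toward hS hne').ne hi
    exact fun i j hij hi hj => h i j hij (hw i hi) (hw j hj) (hi.trans hj.symm)
  have h2 : ∀ i j, i ≠ j →
      toward hS (Sum.inl w) (y i) ≠ toward hS (Sum.inl w) (Sum.inl w') →
      toward hS (Sum.inl w) (y j) = toward hS (Sum.inl w) (Sum.inl w') := by
    intro i j hij hi
    by_contra hj
    have hi' := toward_eq_of_toward_ne hS hne' hi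
    have hj' := toward_eq_of_toward_ne hS hne' hj
    exact h' i j hij hi'.1 hj'.1 (hi'.2.trans hj'.2.symm)
  let i₀ : Fin (n + 1) := ⟨0, by omega⟩
  let i₁ : Fin (n + 1) := ⟨1, by omega⟩
  let i₂ : Fin (n + 1) := ⟨2, by omega⟩
  have h01 : i₀ ≠ i₁ := by simp [i₀, i₁]
  have h02 : i₀ ≠ i₂ := by simp [i₀, i₂]
  have h12 : i₁ ≠ i₂ := by simp [i₁, i₂]
  by_cases h0 : toward hS (Sum.inl w) (y i₀) = toward hS (Sum.inl w) (Sum.inl w')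
  · exact h1 i₀ i₂ h02 h0 (h2 i₁ i₂ h12 (h1 i₀ i₁ h01 h0))
  · exact h1 i₁ i₂ h12 (h2 i₀ i₁ h01 h0) (h2 i₀ i₂ h02 h0)

theorem toward_smul (hM : G.IsMaximalTree M) (a : 𝒢.FundGroup M)
    (x y : 𝒢.TreeVertex M ⊕ 𝒢.TreeEdge M) :
    toward (𝒢.subdivision_isTree hM) (a • x) (a • y) =
      a • toward (𝒢.subdivision_isTree hM) x y :=
  (map_toward _ (𝒢.subdivisionHom a) (MulAction.injective a) x y).symm

theorem smul_inl (a : 𝒢.FundGroup M) (w : 𝒢.TreeVertex M) :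
    a • (Sum.inl w : 𝒢.TreeVertex M ⊕ 𝒢.TreeEdge M) = Sum.inl (a • w) := rfl

theorem IsBarycenter.smul (hM : G.IsMaximalTree M) {n : ℕ} {w : 𝒢.TreeVertex M}
    {y : Fin (n + 1) → 𝒢.TreeVertex M ⊕ 𝒢.TreeEdge M} (h : 𝒢.IsBarycenter M w y)
    (a : 𝒢.FundGroup M) : 𝒢.IsBarycenter M (a • w) (fun i => a • y i) := by
  rw [isBarycenter_iff 𝒢 hM] at h ⊢
  simpa only [← smul_inl, 𝒢.toward_smul hM, Ne, smul_left_cancel_iff] using h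

theorem IsBarycenter.comp_perm {n : ℕ} {w : 𝒢.TreeVertex M}
    {y : Fin (n + 1) → 𝒢.TreeVertex M ⊕ 𝒢.TreeEdge M} (h : 𝒢.IsBarycenter M w y)
    (τ : Equiv.Perm (Fin (n + 1))) : 𝒢.IsBarycenter M w (y ∘ τ) :=
  fun i j hij => h (τ i) (τ j) (τ.injective.ne hij)

/-- Barycenters of a tuple with one entry omitted. -/
theorem isBarycenter_succAbove_iff (hM : G.IsMaximalTree M) {n : ℕ} {w : 𝒢.TreeVertex M}
    {y : Fin (n + 2) → 𝒢.TreeVertex M ⊕ 𝒢.TreeEdge M} {k : Fin (n + 2)} :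
    𝒢.IsBarycenter M w (y ∘ k.succAbove) ↔ ∀ i j, i ≠ k → j ≠ k → i ≠ j →
      y i ≠ Sum.inl w → y j ≠ Sum.inl w →
        toward (𝒢.subdivision_isTree hM) (Sum.inl w) (y i) ≠
          toward (𝒢.subdivision_isTree hM) (Sum.inl w) (y j) := by
  rw [isBarycenter_iff 𝒢 hM]
  constructor
  · intro h i j hi hj hij
    obtain ⟨i, rfl⟩ := Fin.exists_succAbove_eq hi
    obtain ⟨j, rfl⟩ := Fin.exists_succAbove_eq hj
    exact h i j fun e => hij (e ▸ rfl)
  · intro h i j hij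
    exact h _ _ (Fin.succAbove_ne k i) (Fin.succAbove_ne k j)
      (Fin.succAbove_right_injective.ne hij)

/-! ### The stars of the Bass–Serre tree -/

theorem p_smul (a : 𝒢.FundGroup M) (x : 𝒢.GlobalSet M) : 𝒢.p M (a • x) = a • 𝒢.p M x := by
  cases x <;> rfl

/-- The projection `p` is injective over the edges of the tree. -/
theorem eq_of_p_eq_inr {x y : 𝒢.GlobalSet M} {η : 𝒢.TreeEdge M} (hx : 𝒢.p M x = Sum.inr η)
    (hy : 𝒢.p M y = Sum.inr η) : x = y := by
  rcases x with ⟨g, v⟩ | ⟨ε, c⟩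
  · cases hx
  rcases y with ⟨g', v'⟩ | ⟨ε', c'⟩
  · cases hy
  have := Sum.inr_injective (hx.trans hy.symm)
  cases this
  rfl

theorem shift_ori (ε : G.GeomEdge) : 𝒢.shift M (G.ori ε) = 1 :=
  if_pos (G.ori_geom_ori ε)

theorem shift_bar_ori (ε : G.GeomEdge) :
    𝒢.shift M (G.bar (G.ori ε)) = 𝒢.edgeElt M (G.ori ε) := by
  have : ¬ G.ori (G.geom (G.bar (G.ori ε))) = G.bar (G.ori ε) := by
    rw [G.ori_geom_bar_ori]
    exact (G.bar_ne _).symm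
  rw [shift, if_neg this, edgeElt_bar, inv_inv]

/-- The element `shift e` conjugates the two embeddings of the edge group into each other. -/
theorem shift_mul_edge (ε : G.GeomEdge) (e : E) (he : G.geom e = ε) (a : 𝒢.edgeGroup ε) :
    𝒢.shift M e * 𝒢.vertexMap M _ (𝒢.h ε (G.ori ε) (G.geom_ori ε) a) =
      𝒢.vertexMap M _ (𝒢.h ε e he a) * 𝒢.shift M e := by
  obtain ⟨ε', rfl | rfl⟩ := G.exists_ori_or_bar_ori e
  · obtain rfl : ε' = ε := (G.geom_ori ε').symm.trans he
    rw [shift_ori, one_mul, mul_one]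
  · obtain rfl : ε' = ε := ((G.geom_bar _).trans (G.geom_ori ε')).symm.trans he
    rw [shift_bar_ori, ← 𝒢.edge_relation M ε' (G.ori ε') (G.geom_ori ε') a,
      inv_mul_cancel_right]

theorem p_phiMap_edge {v : V} {ε : G.GeomEdge} (e : E) (he : G.t e = v) (hε : G.geom e = ε)
    (γ : 𝒢.vertexGroup v) :
    𝒢.p M (𝒢.phiMap M v (.edge e he (QuotientGroup.mk γ))) =
      Sum.inr (𝒢.edg M ε (𝒢.vertexMap M v γ * 𝒢.shift M e)) := by
  subst hε
  rfl

/-- The two ends of an edge of the Bass–Serre tree differ, whatever representatives are used. -/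
theorem vtx_terminus_ne_of_edg_eq (hM : G.IsMaximalTree M) {ε : G.GeomEdge}
    {g g' : 𝒢.FundGroup M} (h : 𝒢.edg M ε g = 𝒢.edg M ε g') :
    𝒢.vtx M (G.t (G.ori ε)) g ≠
      𝒢.vtx M (G.o (G.ori ε)) (g' * (𝒢.edgeElt M (G.ori ε))⁻¹) := by
  obtain ⟨a, rfl⟩ := 𝒢.edg_eq_edg_iff.1 h
  rw [vtx_origin_mul_edge]
  exact 𝒢.vtx_terminus_ne_vtx_origin hM ε g

theorem phiMap_injective (hM : G.IsMaximalTree M) (v : V) :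
    Function.Injective (𝒢.phiMap M v) := by
  -- The two orientations of an edge of `G` are never sent to the same edge of the tree.
  have hbar : ∀ (ε : G.GeomEdge) (h : G.t (G.ori ε) = v) (h' : G.t (G.bar (G.ori ε)) = v)
      (a a' : 𝒢.vertexGroup v),
      𝒢.phiMap M v (.edge (G.ori ε) h (QuotientGroup.mk a)) ≠
        𝒢.phiMap M v (.edge (G.bar (G.ori ε)) h' (QuotientGroup.mk a')) := by
    intro ε h h' a a' heq
    have heq := congrArg (𝒢.p M) heq
    rw [𝒢.p_phiMap_edge _ h (G.geom_ori ε),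
      𝒢.p_phiMap_edge _ h' ((G.geom_bar _).trans (G.geom_ori ε)), shift_ori, shift_bar_ori,
      mul_one] at heq
    refine 𝒢.vtx_terminus_ne_of_edg_eq hM (Sum.inr_injective heq) ?_
    rw [mul_inv_cancel_right, ← G.t_bar, h, h', ← one_mul (𝒢.vertexMap M v a),
      ← one_mul (𝒢.vertexMap M v a'), vtx_mul_vertexMap, vtx_mul_vertexMap]
  rintro (a | ⟨e, he, c⟩) (a' | ⟨e', he', c'⟩) h
  · exact congrArg _ (𝒢.vertexMap_injective hM v (GlobalSet.pt.inj h).1)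
  · cases h
  · cases h
  · obtain ⟨a, rfl⟩ := QuotientGroup.mk_surjective c
    obtain ⟨a', rfl⟩ := QuotientGroup.mk_surjective c'
    have hgeom : G.geom e = G.geom e' := (GlobalSet.edge.inj h).1
    rcases G.eq_or_eq_bar hgeom with rfl | rfl
    · subst he
      have h := congrArg (𝒢.p M) h
      rw [𝒢.p_phiMap_edge _ rfl rfl, 𝒢.p_phiMap_edge _ rfl rfl] at h
      obtain ⟨b, hb⟩ := 𝒢.edg_eq_edg_iff.1 (Sum.inr_injective h)
      rw [mul_assoc, 𝒢.shift_mul_edge _ _ rfl, ← mul_assoc] at hb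
      have hb' := mul_right_cancel hb
      rw [← map_mul] at hb'
      rw [𝒢.vertexMap_injective hM _ hb']
      exact congrArg (LocalSet.edge _ rfl) (QuotientGroup.eq.2 ⟨b, by group⟩)
    · obtain ⟨ε, rfl | rfl⟩ := G.exists_ori_or_bar_ori e
      · exact (hbar ε he he' a a' h).elim
      · revert he' h
        rw [G.bar_bar]
        intro he' h
        exact (hbar ε he' he a' a h.symm).elim

/-- Every edge at the vertex `gΓ_v` comes from the local set `S_v`. -/
theorem exists_local_of_incident {v : V} {g : 𝒢.FundGroup M} {η : 𝒢.TreeEdge M}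
    (h : 𝒢.Incident M (𝒢.vtx M v g) η) :
    ∃ y, 𝒢.p M (g • 𝒢.phiMap M v y) = Sum.inr η := by
  obtain ⟨ε, g₁, rfl⟩ := 𝒢.edg_surjective η
  rcases 𝒢.incident_edg_iff.1 h with h | h
  · obtain rfl : v = G.t (G.ori ε) := (Sigma.mk.inj h).1
    obtain ⟨γ, rfl⟩ := 𝒢.vtx_eq_vtx_iff.1 h
    refine ⟨.edge (G.ori ε) rfl (QuotientGroup.mk γ), ?_⟩
    rw [p_smul, 𝒢.p_phiMap_edge _ rfl (G.geom_ori ε), shift_ori, mul_one]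
    rfl
  · obtain rfl : v = G.o (G.ori ε) := (Sigma.mk.inj h).1
    obtain ⟨γ, hγ⟩ := 𝒢.vtx_eq_vtx_iff.1 h
    refine ⟨.edge (G.bar (G.ori ε)) (G.t_bar _) (QuotientGroup.mk γ), ?_⟩
    rw [p_smul, 𝒢.p_phiMap_edge _ (G.t_bar _) ((G.geom_bar _).trans (G.geom_ori ε)),
      shift_bar_ori, mul_inv_eq_iff_eq_mul.1 hγ, mul_assoc]
    rfl

/-! ### The retraction onto a star -/

theorem isRetraction_iff (hM : G.IsMaximalTree M) {w : 𝒢.TreeVertex M} {x s : 𝒢.GlobalSet M} :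
    𝒢.IsRetraction M w x s ↔ (𝒢.p M x = Sum.inl w ∧ s = x) ∨ (𝒢.p M x ≠ Sum.inl w ∧
      𝒢.p M s = toward (𝒢.subdivision_isTree hM) (Sum.inl w) (𝒢.p M x)) := by
  have hS := 𝒢.subdivision_isTree hM
  have hpath : (∃ P : (𝒢.subdivision M).Walk (Sum.inl w) (𝒢.p M x),
      P.IsPath ∧ P.snd = 𝒢.p M s) ↔ 𝒢.p M s = toward hS (Sum.inl w) (𝒢.p M x) := by
    constructor
    · rintro ⟨P, hP, h⟩
      rw [← h, snd_eq_toward hS hP]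
    · intro h
      obtain ⟨P, hP, -⟩ := hS.existsUnique_path (Sum.inl w) (𝒢.p M x)
      exact ⟨P, hP, by rw [h, snd_eq_toward hS hP]⟩
  rw [IsRetraction, hpath]
  by_cases hx : 𝒢.p M x = Sum.inl w
  · simp [hx, nbhd]
  by_cases hadj : (𝒢.subdivision M).Adj (Sum.inl w) (𝒢.p M x)
  · have hmem : 𝒢.p M x ∈ 𝒢.nbhd M w := Or.inr hadj
    simp only [hmem, hx, not_true, true_and, false_and, or_false, false_or, ne_eq,
      not_false_eq_true, toward_of_adj hS hadj]
    constructor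
    · rintro rfl
      rfl
    · intro h
      rcases hpx : 𝒢.p M x with w' | η
      · rw [hpx] at hadj
        exact hadj.elim
      · exact 𝒢.eq_of_p_eq_inr (h.trans hpx) hpx
  · have hmem : 𝒢.p M x ∉ 𝒢.nbhd M w := fun h => h.elim hx hadj
    simp [hmem, hx]

/-- The retraction `r_w` with `w = gΓ_v`, in the coordinates `y ↦ g φ_v(y)` on the star of `w`. -/
theorem existsUnique_isRetraction (hM : G.IsMaximalTree M) (v : V) (g : 𝒢.FundGroup M)
    (x : 𝒢.GlobalSet M) :
    ∃! y : 𝒢.LocalSet v, 𝒢.IsRetraction M (𝒢.vtx M v g) x (g • 𝒢.phiMap M v y) := by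
  have hS := 𝒢.subdivision_isTree hM
  have hinj : ∀ y y', g • 𝒢.phiMap M v y = g • 𝒢.phiMap M v y' → y = y' := fun y y' h =>
    𝒢.phiMap_injective hM v (MulAction.injective g h)
  simp only [isRetraction_iff 𝒢 hM]
  by_cases hx : 𝒢.p M x = Sum.inl (𝒢.vtx M v g)
  · simp only [hx, ne_eq, not_true, true_and, false_and, or_false]
    rcases x with ⟨g', v'⟩ | ⟨ε, c⟩
    · have h : 𝒢.vtx M v' g' = 𝒢.vtx M v g := Sum.inl_injective hx
      obtain rfl : v' = v := (Sigma.mk.inj h).1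
      obtain ⟨γ, rfl⟩ := 𝒢.vtx_eq_vtx_iff.1 h.symm
      exact ⟨.pt γ, rfl, fun y' hy' => hinj _ _ (hy'.trans rfl)⟩
    · cases hx
  · simp only [hx, ne_eq, not_false_eq_true, false_and, true_and, false_or]
    have hadj := adj_toward hS hx
    rcases htow : toward hS (Sum.inl (𝒢.vtx M v g)) (𝒢.p M x) with w' | η
    · rw [htow] at hadj
      exact hadj.elim
    · rw [htow] at hadj
      obtain ⟨y, hy⟩ := 𝒢.exists_local_of_incident hadj
      exact ⟨y, hy, fun y' hy' => hinj _ _ (𝒢.eq_of_p_eq_inr hy' hy)⟩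

/-- The point `y ∈ S_v` with `g φ_v(y) = r_w(x)` for `w = gΓ_v`. -/
def localRetraction (hM : G.IsMaximalTree M) (v : V) (g : 𝒢.FundGroup M) (x : 𝒢.GlobalSet M) :
    𝒢.LocalSet v :=
  (𝒢.existsUnique_isRetraction hM v g x).choose

theorem isRetraction_localRetraction (hM : G.IsMaximalTree M) (v : V) (g : 𝒢.FundGroup M)
    (x : 𝒢.GlobalSet M) : 𝒢.IsRetraction M (𝒢.vtx M v g) x
      (g • 𝒢.phiMap M v (𝒢.localRetraction hM v g x)) :=
  (𝒢.existsUnique_isRetraction hM v g x).choose_spec.1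

theorem localRetraction_eq (hM : G.IsMaximalTree M) {v : V} {g : 𝒢.FundGroup M}
    {x : 𝒢.GlobalSet M} {y : 𝒢.LocalSet v}
    (h : 𝒢.IsRetraction M (𝒢.vtx M v g) x (g • 𝒢.phiMap M v y)) :
    𝒢.localRetraction hM v g x = y :=
  ((𝒢.existsUnique_isRetraction hM v g x).choose_spec.2 y h).symm

theorem localRetraction_smul (hM : G.IsMaximalTree M) (v : V) (a g : 𝒢.FundGroup M)
    (x : 𝒢.GlobalSet M) :
    𝒢.localRetraction hM v (a * g) (a • x) = 𝒢.localRetraction hM v g x := by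
  refine 𝒢.localRetraction_eq hM ?_
  have h := 𝒢.isRetraction_localRetraction hM v g x
  rw [isRetraction_iff 𝒢 hM] at h ⊢
  rw [mul_smul, p_smul, p_smul, ← smul_vtx, ← smul_inl, 𝒢.toward_smul hM, Ne, smul_left_cancel_iff,
    smul_left_cancel_iff, smul_left_cancel_iff]
  exact h

theorem localRetraction_mul_vertexMap (hM : G.IsMaximalTree M) (v : V) (g : 𝒢.FundGroup M)
    (γ : 𝒢.vertexGroup v) (x : 𝒢.GlobalSet M) :
    𝒢.localRetraction hM v (g * 𝒢.vertexMap M v γ) x = γ⁻¹ • 𝒢.localRetraction hM v g x := by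
  refine 𝒢.localRetraction_eq hM ?_
  rw [vtx_mul_vertexMap, phiMap_smul, smul_smul, map_inv, mul_inv_cancel_right]
  exact 𝒢.isRetraction_localRetraction hM v g x

theorem p_phiMap_mem_nbhd (v : V) (y : 𝒢.LocalSet v) :
    𝒢.p M (𝒢.phiMap M v y) ∈ 𝒢.nbhd M (𝒢.vtx M v 1) := by
  rcases y with γ | ⟨e, he, c⟩
  · refine Or.inl (congrArg Sum.inl ?_)
    rw [← one_mul (𝒢.vertexMap M v γ), vtx_mul_vertexMap]
  · obtain ⟨γ, rfl⟩ := QuotientGroup.mk_surjective c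
    refine Or.inr ?_
    have hγ : 𝒢.vtx M v (𝒢.vertexMap M v γ) = 𝒢.vtx M v 1 := by
      rw [← one_mul (𝒢.vertexMap M v γ), vtx_mul_vertexMap]
    obtain ⟨ε, rfl | rfl⟩ := G.exists_ori_or_bar_ori e
    · rw [𝒢.p_phiMap_edge _ he (G.geom_ori ε), shift_ori, mul_one]
      subst he
      exact 𝒢.incident_edg_iff.2 (Or.inl hγ.symm)
    · rw [𝒢.p_phiMap_edge _ he ((G.geom_bar _).trans (G.geom_ori ε)), shift_bar_ori]
      refine 𝒢.incident_edg_iff.2 (Or.inr ?_)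
      rw [mul_inv_cancel_right, ← G.t_bar, he, hγ]

theorem localRetraction_phiMap (hM : G.IsMaximalTree M) (v : V) (y : 𝒢.LocalSet v) :
    𝒢.localRetraction hM v (1 : 𝒢.FundGroup M) (𝒢.phiMap M v y) = y := by
  refine 𝒢.localRetraction_eq hM (Or.inl ⟨𝒢.p_phiMap_mem_nbhd v y, one_smul _ _⟩)

/-- Points in the same branch at `w` have the same retraction. -/
theorem localRetraction_eq_of_toward_eq (hM : G.IsMaximalTree M) {v : V} {g : 𝒢.FundGroup M}
    {x x' : 𝒢.GlobalSet M} (hx : 𝒢.p M x ≠ Sum.inl (𝒢.vtx M v g))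
    (hx' : 𝒢.p M x' ≠ Sum.inl (𝒢.vtx M v g))
    (h : toward (𝒢.subdivision_isTree hM) (Sum.inl (𝒢.vtx M v g)) (𝒢.p M x) =
      toward (𝒢.subdivision_isTree hM) (Sum.inl (𝒢.vtx M v g)) (𝒢.p M x')) :
    𝒢.localRetraction hM v g x = 𝒢.localRetraction hM v g x' := by
  refine 𝒢.localRetraction_eq hM ?_
  have h1 := 𝒢.isRetraction_localRetraction hM v g x'
  rw [isRetraction_iff 𝒢 hM] at h1 ⊢
  exact Or.inr ⟨hx, (h1.resolve_left fun h => hx' h.1).2.trans h.symm⟩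

end GraphOfGroups

/-- A sum vanishes if its nonzero terms can be matched in cancelling pairs. -/
theorem sum_eq_zero_of_pairing {ι : Type*} [Fintype ι] (a : ι → ℝ) (R : ι → ι → Prop)
    (hirrefl : ∀ i, ¬ R i i) (hsymm : ∀ i j, R i j → R j i)
    (huniq : ∀ i j k, R i j → R i k → j = k) (hcancel : ∀ i j, R i j → a i + a j = 0)
    (hex : ∀ i, a i ≠ 0 → ∃ j, R i j) : ∑ i, a i = 0 := by
  classical
  let m : ι → ι := fun i => if h : ∃ j, R i j then h.choose else i
  have hm : ∀ i j, R i j → m i = j := by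
    intro i j h
    have h' : ∃ j, R i j := ⟨j, h⟩
    have h1 : m i = h'.choose := dif_pos h'
    rw [h1]
    exact huniq i _ _ h'.choose_spec h
  have hm' : ∀ i, (¬ ∃ j, R i j) → m i = i ∧ a i = 0 := fun i h =>
    ⟨dif_neg h, by_contra fun h0 => h (hex i h0)⟩
  refine Finset.sum_involution (fun i _ => m i) ?_ ?_ (fun _ _ => Finset.mem_univ _) ?_
  · intro i _
    by_cases h : ∃ j, R i j
    · obtain ⟨j, h⟩ := h
      rw [hm i j h, hcancel i j h]
    · rw [(hm' i h).1, (hm' i h).2, add_zero]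
  · intro i _ hi
    obtain ⟨j, h⟩ := hex i hi
    rw [hm i j h]
    rintro rfl
    exact hirrefl _ h
  · intro i _
    by_cases h : ∃ j, R i j
    · obtain ⟨j, h⟩ := h
      rw [hm i j h, hm j i (hsymm i j h)]
    · simp only [(hm' i h).1]

namespace GraphOfGroups

variable {V E : Type*} {G : SerreGraph V E} (𝒢 : GraphOfGroups G) {M : Set E}

/-! ### The extension of local cochains -/

/-- The value `f_v(r_w(x_0), …, r_w(x_n))` at the star of `w = gΓ_v`, identified with `S_v`. -/
def starValue (hM : G.IsMaximalTree M) {n : ℕ}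
    (f : ∀ v, AltCochain (𝒢.vertexGroup v) (𝒢.LocalSet v) n) (v : V) (g : 𝒢.FundGroup M)
    (x : Fin (n + 1) → 𝒢.GlobalSet M) : ℝ :=
  (f v).eval fun i => 𝒢.localRetraction hM v g (x i)

/-- The value at the star of a vertex does not depend on the coset representative. -/
theorem starValue_congr (hM : G.IsMaximalTree M) {n : ℕ}
    (f : ∀ v, AltCochain (𝒢.vertexGroup v) (𝒢.LocalSet v) n) {v v' : V} {g g' : 𝒢.FundGroup M}
    (h : 𝒢.vtx M v g = 𝒢.vtx M v' g') (x : Fin (n + 1) → 𝒢.GlobalSet M) :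
    𝒢.starValue hM f v g x = 𝒢.starValue hM f v' g' x := by
  obtain rfl : v = v' := (Sigma.mk.inj h).1
  obtain ⟨γ, rfl⟩ := 𝒢.vtx_eq_vtx_iff.1 h
  simp only [starValue, localRetraction_mul_vertexMap, AltCochain.eval_smul]

open Classical in
/-- The value of the extended cochain at `x`: the value at the star of a barycenter of `p ∘ x`, and
zero if there is none. -/
def extendFun (hM : G.IsMaximalTree M) {n : ℕ}
    (f : ∀ v, AltCochain (𝒢.vertexGroup v) (𝒢.LocalSet v) n)
    (x : Fin (n + 1) → 𝒢.GlobalSet M) : ℝ :=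
  if h : ∃ q : V × 𝒢.FundGroup M, 𝒢.IsBarycenter M (𝒢.vtx M q.1 q.2) (𝒢.p M ∘ x) then
    𝒢.starValue hM f h.choose.1 h.choose.2 x
  else 0

theorem extendFun_of_isBarycenter (hM : G.IsMaximalTree M) {n : ℕ} (hn : 2 ≤ n)
    (f : ∀ v, AltCochain (𝒢.vertexGroup v) (𝒢.LocalSet v) n)
    {x : Fin (n + 1) → 𝒢.GlobalSet M} {v : V} {g : 𝒢.FundGroup M}
    (h : 𝒢.IsBarycenter M (𝒢.vtx M v g) (𝒢.p M ∘ x)) :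
    𝒢.extendFun hM f x = 𝒢.starValue hM f v g x := by
  have h' : ∃ q : V × 𝒢.FundGroup M, 𝒢.IsBarycenter M (𝒢.vtx M q.1 q.2) (𝒢.p M ∘ x) :=
    ⟨(v, g), h⟩
  rw [extendFun, dif_pos h']
  exact 𝒢.starValue_congr hM f (IsBarycenter.unique 𝒢 hM hn h'.choose_spec h) x

theorem extendFun_of_not_exists (hM : G.IsMaximalTree M) {n : ℕ}
    (f : ∀ v, AltCochain (𝒢.vertexGroup v) (𝒢.LocalSet v) n)
    {x : Fin (n + 1) → 𝒢.GlobalSet M} (h : ¬ ∃ w, 𝒢.IsBarycenter M w (𝒢.p M ∘ x)) :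
    𝒢.extendFun hM f x = 0 :=
  dif_neg fun ⟨_, hq⟩ => h ⟨_, hq⟩

theorem exists_isBarycenter_or {n : ℕ} (x : Fin (n + 1) → 𝒢.GlobalSet M) :
    (∃ v g, 𝒢.IsBarycenter M (𝒢.vtx M v g) (𝒢.p M ∘ x)) ∨
      ¬ ∃ w, 𝒢.IsBarycenter M w (𝒢.p M ∘ x) := by
  by_cases h : ∃ w, 𝒢.IsBarycenter M w (𝒢.p M ∘ x)
  · obtain ⟨w, hw⟩ := h
    obtain ⟨v, g, rfl⟩ := 𝒢.vtx_surjective w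
    exact Or.inl ⟨v, g, hw⟩
  · exact Or.inr h

theorem abs_extendFun_le [Fintype V] (hM : G.IsMaximalTree M) {n : ℕ}
    (f : ∀ v, AltCochain (𝒢.vertexGroup v) (𝒢.LocalSet v) n) (x : Fin (n + 1) → 𝒢.GlobalSet M) :
    |𝒢.extendFun hM f x| ≤ ‖f‖ := by
  unfold extendFun
  split_ifs with h
  · exact ((f _).eval_le _).trans (norm_le_pi_norm f _)
  · rw [abs_zero]
    exact norm_nonneg f

theorem extendFun_comp_perm (hM : G.IsMaximalTree M) {n : ℕ} (hn : 2 ≤ n)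
    (f : ∀ v, AltCochain (𝒢.vertexGroup v) (𝒢.LocalSet v) n) (τ : Equiv.Perm (Fin (n + 1)))
    (x : Fin (n + 1) → 𝒢.GlobalSet M) :
    𝒢.extendFun hM f (x ∘ τ) = ((Equiv.Perm.sign τ : ℤ) : ℝ) * 𝒢.extendFun hM f x := by
  rcases 𝒢.exists_isBarycenter_or x with ⟨v, g, h⟩ | h
  · rw [𝒢.extendFun_of_isBarycenter hM hn f h,
      𝒢.extendFun_of_isBarycenter hM hn f (x := x ∘ τ) (IsBarycenter.comp_perm 𝒢 h τ)]
    exact (f v).eval_perm τ fun i => 𝒢.localRetraction hM v g (x i)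
  · rw [𝒢.extendFun_of_not_exists hM f h, mul_zero]
    refine 𝒢.extendFun_of_not_exists hM f fun ⟨w, hw⟩ => h ⟨w, ?_⟩
    have := IsBarycenter.comp_perm 𝒢 hw τ⁻¹
    rwa [Function.comp_assoc, Function.comp_assoc, ← Equiv.Perm.coe_mul, mul_inv_cancel,
      Equiv.Perm.coe_one, Function.comp_id] at this

theorem extendFun_smul (hM : G.IsMaximalTree M) {n : ℕ} (hn : 2 ≤ n)
    (f : ∀ v, AltCochain (𝒢.vertexGroup v) (𝒢.LocalSet v) n) (a : 𝒢.FundGroup M)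
    (x : Fin (n + 1) → 𝒢.GlobalSet M) :
    𝒢.extendFun hM f (fun i => a • x i) = 𝒢.extendFun hM f x := by
  have hsmul : ∀ (a : 𝒢.FundGroup M) (x : Fin (n + 1) → 𝒢.GlobalSet M) w,
      𝒢.IsBarycenter M w (𝒢.p M ∘ x) →
        𝒢.IsBarycenter M (a • w) (𝒢.p M ∘ fun i => a • x i) := by
    intro a x w h
    have h2 : (𝒢.p M ∘ fun i => a • x i) = fun i => a • (𝒢.p M ∘ x) i :=
      funext fun i => 𝒢.p_smul a (x i)
    rw [h2]
    exact IsBarycenter.smul 𝒢 hM h a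
  rcases 𝒢.exists_isBarycenter_or x with ⟨v, g, h⟩ | h
  · have h' := hsmul a x _ h
    rw [smul_vtx] at h'
    rw [𝒢.extendFun_of_isBarycenter hM hn f h, 𝒢.extendFun_of_isBarycenter hM hn f h']
    simp only [starValue, localRetraction_smul]
  · rw [𝒢.extendFun_of_not_exists hM f h]
    refine 𝒢.extendFun_of_not_exists hM f fun ⟨w, hw⟩ => h ⟨a⁻¹ • w, ?_⟩
    simpa only [inv_smul_smul] using hsmul a⁻¹ _ w hw

/-- The linear map `ψ^n`, for `n ≥ 2`. -/
def extend [Fintype V] (hM : G.IsMaximalTree M) {n : ℕ} (hn : 2 ≤ n) :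
    (∀ v, AltCochain (𝒢.vertexGroup v) (𝒢.LocalSet v) n) →ₗ[ℝ]
      AltCochain (𝒢.FundGroup M) (𝒢.GlobalSet M) n where
  toFun f := AltCochain.mk (𝒢.extendFun hM f) ⟨‖f‖, 𝒢.abs_extendFun_le hM f⟩
    (𝒢.extendFun_comp_perm hM hn f) (𝒢.extendFun_smul hM hn f)
  map_add' f f' := AltCochain.ext_eval fun x => by
    rw [AltCochain.eval_add]
    simp only [AltCochain.eval_mk, extendFun]
    split_ifs
    · rfl
    · exact (add_zero 0).symm
  map_smul' c f := AltCochain.ext_eval fun x => by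
    rw [RingHom.id_apply, AltCochain.eval_real_smul]
    simp only [AltCochain.eval_mk, extendFun]
    split_ifs
    · rfl
    · exact (mul_zero c).symm

theorem eval_extend [Fintype V] (hM : G.IsMaximalTree M) {n : ℕ} (hn : 2 ≤ n)
    (f : ∀ v, AltCochain (𝒢.vertexGroup v) (𝒢.LocalSet v) n) (x : Fin (n + 1) → 𝒢.GlobalSet M) :
    (𝒢.extend hM hn f).eval x = 𝒢.extendFun hM f x := rfl

/-- If `x` has no barycenter, then the terms of the coboundary at `x` cancel in pairs. Namely, if `w`
is a barycenter after omitting `x_i`, then exactly one other entry `x_j` lies in the branch of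
`x_i` at `w`; omitting `x_j` yields the same barycenter and, up to sign, the same value. -/
theorem sum_extendFun_succAbove_eq_zero (hM : G.IsMaximalTree M) {n : ℕ} (hn : 2 ≤ n)
    (f : ∀ v, AltCochain (𝒢.vertexGroup v) (𝒢.LocalSet v) n)
    {x : Fin (n + 2) → 𝒢.GlobalSet M} (hx : ¬ ∃ w, 𝒢.IsBarycenter M w (𝒢.p M ∘ x)) :
    ∑ i : Fin (n + 2), (-1 : ℝ) ^ (i : ℕ) * 𝒢.extendFun hM f (x ∘ i.succAbove) = 0 := by
  have hS := 𝒢.subdivision_isTree hM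
  -- `R i j`: the entries `i` and `j` share a branch at a barycenter of the tuple without `x i`.
  let R : Fin (n + 2) → Fin (n + 2) → Prop := fun i j => i ≠ j ∧ ∃ w,
    𝒢.IsBarycenter M w ((𝒢.p M ∘ x) ∘ i.succAbove) ∧ 𝒢.p M (x i) ≠ Sum.inl w ∧
      𝒢.p M (x j) ≠ Sum.inl w ∧
      toward hS (Sum.inl w) (𝒢.p M (x i)) = toward hS (Sum.inl w) (𝒢.p M (x j))
  have hbary : ∀ i j w, 𝒢.IsBarycenter M w ((𝒢.p M ∘ x) ∘ i.succAbove) →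
      𝒢.p M (x i) ≠ Sum.inl w → i ≠ j →
      toward hS (Sum.inl w) (𝒢.p M (x i)) = toward hS (Sum.inl w) (𝒢.p M (x j)) →
      𝒢.p M (x j) ≠ Sum.inl w → 𝒢.IsBarycenter M w ((𝒢.p M ∘ x) ∘ j.succAbove) := by
    intro i j w hw hi hij hij' hj
    rw [isBarycenter_succAbove_iff 𝒢 hM] at hw ⊢
    intro k l hk hl hkl hk' hl'
    by_cases hki : k = i
    · subst hki
      have := hw j l hij.symm hkl.symm hl.symm hj hl'
      simp only [Function.comp_apply] at this ⊢
      rwa [hij']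
    by_cases hli : l = i
    · subst hli
      have := hw k j hki hij.symm hk hk' hj
      simp only [Function.comp_apply] at this ⊢
      rwa [hij']
    · exact hw k l hki hli hkl hk' hl'
  refine sum_eq_zero_of_pairing _ R (fun i h => h.1 rfl) ?_ ?_ ?_ ?_
  · rintro i j ⟨hij, w, hw, hi, hj, h⟩
    exact ⟨hij.symm, w, hbary i j w hw hi hij h hj, hj, hi, h.symm⟩
  · rintro i j k ⟨hij, w, hw, hi, hj, h⟩ ⟨hik, w', hw', -, hk, h'⟩
    obtain rfl := IsBarycenter.unique 𝒢 hM hn hw hw'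
    by_contra hjk
    exact (isBarycenter_succAbove_iff 𝒢 hM).1 hw j k hij.symm hik.symm hjk hj hk (h.symm.trans h')
  · rintro i j ⟨hij, w, hw, hi, hj, h⟩
    have hw' := hbary i j w hw hi hij h hj
    obtain ⟨v, g, rfl⟩ := 𝒢.vtx_surjective w
    rw [𝒢.extendFun_of_isBarycenter hM hn f (x := x ∘ i.succAbove) hw,
      𝒢.extendFun_of_isBarycenter hM hn f (x := x ∘ j.succAbove) hw']
    exact (f v).eval_succAbove_cancel (x := fun k => 𝒢.localRetraction hM v g (x k)) hij
      (𝒢.localRetraction_eq_of_toward_eq hM hi hj h)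
  · intro i hi
    rcases 𝒢.exists_isBarycenter_or (x ∘ i.succAbove) with ⟨v, g, hw⟩ | h
    · have hw' := (isBarycenter_succAbove_iff 𝒢 hM (y := 𝒢.p M ∘ x)).1 hw
      by_contra hno
      refine hx ⟨𝒢.vtx M v g, (isBarycenter_iff 𝒢 hM).2 fun k l hkl hk hl heq => ?_⟩
      by_cases hki : k = i
      · subst hki
        exact hno ⟨l, hkl, _, hw, hk, hl, heq⟩
      by_cases hli : l = i
      · subst hli
        exact hno ⟨k, hkl.symm, _, hw, hl, hk, heq.symm⟩
      · exact hw' k l hki hli hkl hk hl heq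
    · rw [𝒢.extendFun_of_not_exists hM f h, mul_zero] at hi
      exact (hi rfl).elim

theorem extend_delta [Fintype V] (hM : G.IsMaximalTree M) {n : ℕ} (hn : 2 ≤ n)
    (f : ∀ v, AltCochain (𝒢.vertexGroup v) (𝒢.LocalSet v) n) :
    𝒢.extend hM (hn.trans n.le_succ)
        (fun v => delta (𝒢.vertexGroup v) (𝒢.LocalSet v) n (f v)) =
      delta (𝒢.FundGroup M) (𝒢.GlobalSet M) n (𝒢.extend hM hn f) := by
  refine AltCochain.ext_eval fun x => ?_
  rw [AltCochain.eval_delta, eval_extend]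
  simp only [eval_extend]
  rcases 𝒢.exists_isBarycenter_or x with ⟨v, g, h⟩ | h
  · rw [𝒢.extendFun_of_isBarycenter hM (hn.trans n.le_succ) _ h, starValue,
      AltCochain.eval_delta]
    refine Finset.sum_congr rfl fun i _ => ?_
    rw [𝒢.extendFun_of_isBarycenter hM hn f (x := x ∘ i.succAbove) (v := v) (g := g)
      fun j k hjk => h _ _ (Fin.succAbove_right_injective.ne hjk)]
    rfl
  · rw [𝒢.extendFun_of_not_exists hM _ h, 𝒢.sum_extendFun_succAbove_eq_zero hM hn f h]

theorem phi_comp_extend [Fintype V] (hM : G.IsMaximalTree M) {n : ℕ} (hn : 2 ≤ n) :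
    𝒢.phi M n ∘ₗ 𝒢.extend hM hn = LinearMap.id := by
  refine LinearMap.ext fun f => funext fun v => AltCochain.ext_eval fun y => ?_
  change (𝒢.extend hM hn f).eval (𝒢.phiMap M v ∘ y) = (f v).eval y
  by_cases h : 𝒢.IsBarycenter M (𝒢.vtx M v 1) (𝒢.p M ∘ (𝒢.phiMap M v ∘ y))
  · rw [eval_extend, 𝒢.extendFun_of_isBarycenter hM hn f h, starValue]
    simp only [Function.comp_apply, localRetraction_phiMap]
  · -- Two entries of `y` coincide, so both sides vanish by alternation.
    rw [isBarycenter_iff 𝒢 hM] at h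
    push Not at h
    obtain ⟨i, j, hij, hi, hj, heq⟩ := h
    have h1 := 𝒢.localRetraction_eq_of_toward_eq hM hi hj heq
    simp only [Function.comp_apply, localRetraction_phiMap] at h1
    rw [(f v).eval_eq_zero hij h1, AltCochain.eval_eq_zero _ hij]
    simp only [Function.comp_apply, h1]

end GraphOfGroups

end BassSerre

end

theorem mainTheorem7 {V E : Type*} [Fintype V] (G : BassSerre.SerreGraph V E)
    (𝒢 : BassSerre.GraphOfGroups G) (M : Set E) (hM : G.IsMaximalTree M) :
    ∃ ψ : ∀ n : ℕ,
      (∀ v, BassSerre.AltCochain (𝒢.vertexGroup v) (𝒢.LocalSet v) n) →ₗ[ℝ]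
        BassSerre.AltCochain (𝒢.FundGroup M) (𝒢.GlobalSet M) n,
      -- norm non-increasing
      (∀ n, 2 ≤ n → ∀ f, ‖ψ n f‖ ≤ ‖f‖) ∧
      -- chain map in degrees at least two
      (∀ n, 2 ≤ n → ∀ f,
        ψ (n + 1) (fun v => BassSerre.delta (𝒢.vertexGroup v) (𝒢.LocalSet v) n (f v)) =
          BassSerre.delta (𝒢.FundGroup M) (𝒢.GlobalSet M) n (ψ n f)) ∧
      -- right inverse of the restriction map
      (∀ n, 2 ≤ n → 𝒢.phi M n ∘ₗ ψ n = LinearMap.id) ∧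
      -- barycenter formula: the value at `x` if `gΓ_v` is a barycenter of `p ∘ x`
      (∀ n, 2 ≤ n → ∀ f (x : Fin (n + 1) → 𝒢.GlobalSet M) (v : V) (g : 𝒢.FundGroup M),
        𝒢.IsBarycenter M (𝒢.vtx M v g) (𝒢.p M ∘ x) →
          ∃ y : Fin (n + 1) → 𝒢.LocalSet v,
            (∀ i, 𝒢.IsRetraction M (𝒢.vtx M v g) (x i) (g • 𝒢.phiMap M v (y i))) ∧
            (ψ n f).eval x = (f v).eval y) ∧
      -- barycenter formula: the value at `x` if there is no barycenter
      (∀ n, 2 ≤ n → ∀ f (x : Fin (n + 1) → 𝒢.GlobalSet M),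
        (¬ ∃ w, 𝒢.IsBarycenter M w (𝒢.p M ∘ x)) → (ψ n f).eval x = 0) := by
  -- In degrees below two nothing is required, and `ψ` is set to zero.
  let ψ : ∀ n : ℕ, (∀ v, BassSerre.AltCochain (𝒢.vertexGroup v) (𝒢.LocalSet v) n) →ₗ[ℝ]
      BassSerre.AltCochain (𝒢.FundGroup M) (𝒢.GlobalSet M) n :=
    fun n => if hn : 2 ≤ n then 𝒢.extend hM hn else 0
  have hψ : ∀ n (hn : 2 ≤ n), ψ n = 𝒢.extend hM hn := fun n hn => dif_pos hn
  refine ⟨ψ, fun n hn f => ?_, fun n hn f => ?_, fun n hn => ?_, fun n hn f x v g h => ?_,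
    fun n hn f x h => ?_⟩
  · rw [hψ n hn]
    exact BassSerre.AltCochain.norm_le (norm_nonneg f) (𝒢.abs_extendFun_le hM f)
  · rw [hψ n hn, hψ (n + 1) (hn.trans n.le_succ)]
    exact 𝒢.extend_delta hM hn f
  · rw [hψ n hn]
    exact 𝒢.phi_comp_extend hM hn
  · rw [hψ n hn]
    exact ⟨_, fun i => 𝒢.isRetraction_localRetraction hM v g (x i),
      𝒢.extendFun_of_isBarycenter hM hn f h⟩
  · rw [hψ n hn]
    exact 𝒢.extendFun_of_not_exists hM f h
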